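/- Conventions. Strings are binary. A random-access Turing machine (RATM) is a multitape Turing machine with a read-only input tape, finitely many work tapes, and a binary index tape for each of these tapes; on entering a random access state it moves the head of every non-index tape, in one step, to the cell described by its index tape. A function of two strings takes them as one input string, on two tracks. "Time polylogarithmic in $n$" means time at most $C(\log_2 n+1)^c$ for constants $C,c$. A function is NC computable if it is computed by logspace-uniform Boolean circuits of bounded fan-in, polynomial size and polylogarithmic depth. An optimization problem $\mathcal P$ (minimization or maximization) specifies which problem instances $P$ are defined on which data $D$, a set $\mathsf{sol}_{\mathcal P}(D,P)$ of feasible solutions, and a positive measure $\tau_{\mathcal P}$ of the feasible solutions of each instance; every instance has an optimum solution, of measure $\mathsf{opt}_{\mathcal P}(D,P)$. For real $r\ge 1$, a pseudo-polylog-time $r$-approximation algorithm for $\mathcal P$ consists of a polynomial-time computable preprocessing function $\Pi$ (whose values are strings over some finite alphabet) and an RATM which, for every instance $P$ on $D$, on input $(\Pi(D),P)$ outputs in time polylogarithmic in $|D|$ a $y\in\mathsf{sol}_{\mathcal P}(D,P)$ with $$\max\left\{\frac{\tau_{\mathcal P}(y)}{\mathsf{opt}_{\mathcal P}(D,P)},\frac{\mathsf{opt}_{\mathcal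 P}(D,P)}{\tau_{\mathcal P}(y)}\right\}\le r .$$ $\mathcal P_1$ pseudo-polylog-time L-reduces to $\mathcal P_2$ with parameters $\alpha,\beta$ if there are NC computable functions $f_1,f_2$ and functions $g,h$ such that for every instance $P$ of $\mathcal P_1$ on $D$, writing $D'=f_1(D)$ and $P'=g(f_2(D),P)$: 1. $P'$ is an instance of $\mathcal P_2$ on $D'$, and $h(f_2(D),y)\in\mathsf{sol}_{\mathcal P_1}(D,P)$ for all $y\in\mathsf{sol}_{\mathcal P_2}(D',P')$; 2. an RATM (the same for all $D,P$) computes $g(f_2(D),P)$ from $(f_2(D),P)$ in time polylogarithmic in $|f_2(D)|$, and an RATM (the same for all $D,P,y$) computes $h(f_2(D),y)$ from $(f_2(D),y)$ in time polylogarithmic in $|f_2(D)|+|y|$, for all $y\in\mathsf{sol}_{\mathcal P_2}(D',P')$; 3. $\mathsf{opt}_{\mathcal P_2}(D',P')\le\alpha\cdot\mathsf{opt}_{\mathcal P_1}(D,P)$; 4. $|\mathsf{opt}_{\mathcal P_1}(D,P)-\tau_{\mathcal P_1}(h(f_2(D),y))|\le\beta\cdot|\mathsf{opt}_{\mathcal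 P_2}(D',P')-\tau_{\mathcal P_2}(y)|$ for all $y\in\mathsf{sol}_{\mathcal P_2}(D',P')$. Theorem. Let $\alpha,\beta,\delta\ge 0$ be real numbers. Suppose that $\mathcal P_1$ pseudo-polylog-time L-reduces to $\mathcal P_2$ with parameters $\alpha,\beta$, and that $\mathcal P_2$ has a pseudo-polylog-time $(1+\delta)$-approximation algorithm. Then $\mathcal P_1$ has a pseudo-polylog-time $(1+\gamma)$-approximation algorithm, where $\gamma=\alpha\beta\delta$ if $\mathcal P_1$ is a minimization problem, and $\gamma=\frac{\alpha\beta\delta}{1-\alpha\beta\delta}$ if $\mathcal P_1$ is a maximization problem and $\alpha\beta\delta<1$. -/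

import Mathlib

/-!  Random-access Turing machines, polynomial-time and NC-computable functions, optimization
problems whose input is split into a data part and a problem part, polylog-time L-reductions. -/

namespace PsPL

/-! ### Tapes -/

/-- Head movements. Tapes are one-way infinite; moving left from cell 0 stays at cell 0. -/
inductive Move where
  | left
  | stay
  | right

/-- The new head position. -/
def Move.apply : Move → ℕ → ℕ
  | Move.left, n => n - 1
  | Move.stay, n => n
  | Move.right, n => n + 1

/-- A tape over the alphabet `X`: cells `0, 1, 2, …` (`none` is the blank) and a head position. -/
structure Tape (X : Type) where
  cells : ℕ → Option X
  head : ℕ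

/-- The symbol under the head. -/
def Tape.read {X : Type} (T : Tape X) : Option X := T.cells T.head

/-- Write `a` (possibly a blank) under the head, then move the head. -/
def Tape.write {X : Type} (T : Tape X) (a : Option X) (m : Move) : Tape X where
  cells := Function.update T.cells T.head a
  head := m.apply T.head

/-- Move the head without writing. -/
def Tape.move {X : Type} (T : Tape X) (m : Move) : Tape X where
  cells := T.cells
  head := m.apply T.head

/-- Put the head on cell `n`. -/
def Tape.goto {X : Type} (T : Tape X) (n : ℕ) : Tape X where
  cells := T.cells
  head := n

/-- The tape that holds the string `l` in its first cells, with the head on cell 0. -/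
def Tape.ofList {X : Type} (l : List X) : Tape X where
  cells := fun i => l[i]?
  head := 0

/-- The number of cells before the first blank. -/
noncomputable def blockLength (cells : ℕ → Option Bool) : ℕ := sInf {i | cells i = none}

/-- The number written in binary (most significant digit first) before the first blank of an
index tape; an empty index tape describes cell 0. -/
noncomputable def indexValue (cells : ℕ → Option Bool) : ℕ :=
  ∑ i ∈ Finset.range (blockLength cells),
    if cells i = some true then 2 ^ (blockLength cells - 1 - i) else 0

/-! ### Random-access Turing machines -/

/-- What a machine does in one transition: the next state, the movement on the (read-only) input
tape, and, for each work tape and each index tape, the symbol written and the movement. Work tapes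
are indexed by `T`, index tapes by `Option T` (`none` belongs to the input tape). -/
structure Action (Q X T : Type) where
  next : Q
  inp : Move
  work : T → Option X × Move
  idx : Option T → Option Bool × Move

/-- A deterministic random-access Turing machine with input alphabet `A` and output alphabet `B`.
It has one read-only input tape, finitely many work tapes (one of them, `out`, receives the output)
over the alphabet `B` extended by the auxiliary symbols `E` and the blank, and one binary index
tape for every one of these tapes. When a state `q` with `jump q = true` is entered, the head of
every non-index tape moves to the cell described by the index tape of that tape. The machine halts
when `tr` gives `none`. -/
structure RATM (A B : Type) where
  Q : Type
  E : Type
  T : Type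
  finQ : Finite Q
  finE : Finite E
  finT : Finite T
  out : T
  start : Q
  jump : Q → Bool
  tr : Q → Option A → (T → Option (B ⊕ E)) → (Option T → Option Bool) →
    Option (Action Q (B ⊕ E) T)

namespace RATM

variable {A B : Type}

/-- Configurations. -/
structure Cfg (M : RATM A B) where
  state : M.Q
  input : Tape A
  work : M.T → Tape (B ⊕ M.E)
  idx : Option M.T → Tape Bool

/-- The initial configuration on input `x`. -/
def init (M : RATM A B) (x : List A) : M.Cfg where
  state := M.start
  input := Tape.ofList x
  work := fun _ => Tape.ofList []
  idx := fun _ => Tape.ofList []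

/-- The random access: each non-index head moves to the cell given by its index tape. -/
noncomputable def access (M : RATM A B) (c : M.Cfg) : M.Cfg where
  state := c.state
  input := c.input.goto (indexValue (c.idx none).cells)
  work := fun t => (c.work t).goto (indexValue (c.idx (some t)).cells)
  idx := c.idx

/-- The effect of an action without random access. -/
def act (M : RATM A B) (c : M.Cfg) (a : Action M.Q (B ⊕ M.E) M.T) : M.Cfg where
  state := a.next
  input := c.input.move a.inp
  work := fun t => (c.work t).write (a.work t).1 (a.work t).2
  idx := fun t => (c.idx t).write (a.idx t).1 (a.idx t).2

/-- One step; `none` if the machine has halted. -/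
noncomputable def step (M : RATM A B) (c : M.Cfg) : Option M.Cfg :=
  (M.tr c.state c.input.read (fun t => (c.work t).read) (fun t => (c.idx t).read)).map fun a =>
    if M.jump a.next = true then M.access (M.act c a) else M.act c a

/-- The configuration after `s` steps on input `x`, if the machine does not halt earlier. -/
noncomputable def run (M : RATM A B) (x : List A) : ℕ → Option M.Cfg
  | 0 => some (M.init x)
  | s + 1 => (M.run x s).bind M.step

/-- On input `x` the machine halts after at most `t` steps, and then the output tape holds the
string `y` in its first cells and nothing else. -/
def OutputsIn (M : RATM A B) (x : List A) (y : List B) (t : ℕ) : Prop :=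
  ∃ s ≤ t, ∃ c, M.run x s = some c ∧ M.step c = none ∧
    ∀ i, (c.work M.out).cells i = y[i]?.map Sum.inl

/-- The machine never uses random access: it is an ordinary multitape Turing machine. -/
def Ordinary (M : RATM A B) : Prop := ∀ q, M.jump q = false

/-- On input `x` the machine works within space `S` (in the sense of transducers): the input head
does not go beyond the first blank, the output head never moves left, and every other head stays
on the cells `0, …, S`. -/
def WithinSpace (M : RATM A B) (x : List A) (S : ℕ) : Prop :=
  (∀ q a w i b, M.tr q a w i = some b → (b.work M.out).2 ≠ Move.left) ∧
  ∀ s c, M.run x s = some c →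
    c.input.head ≤ x.length ∧ (∀ t, t ≠ M.out → (c.work t).head ≤ S) ∧ ∀ t, (c.idx t).head ≤ S

end RATM

/-! ### Function classes -/

/-- `C * (log n + 1) ^ k`, the general form of a polylogarithmic bound. -/
def polylog (C k n : ℕ) : ℕ := C * (Nat.log 2 n + 1) ^ k

/-- `f` is computable by an ordinary Turing machine in polynomial time. -/
def PolyTime {A B : Type} (f : List A → List B) : Prop :=
  ∃ (M : RATM A B) (p : Polynomial ℕ), M.Ordinary ∧
    ∀ x, M.OutputsIn x (f x) (p.eval x.length)

/-- The encoding of a pair of strings as one string: the two strings are written side by side on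
two tracks, the shorter one being padded with blanks. -/
def pair {A B : Type} (x : List A) (y : List B) : List (Option A × Option B) :=
  (List.range (max x.length y.length)).map fun i => (x[i]?, y[i]?)

/-- A random-access Turing machine computes `F x y` from the pair `x, y`, for all pairs in `S`,
in time polylogarithmic in `size x y`. -/
def PolylogTimeOn {A B C : Type} (S : Set (List A × List B)) (size : List A → List B → ℕ)
    (F : List A → List B → List C) : Prop :=
  ∃ (M : RATM (Option A × Option B) C) (K k : ℕ), ∀ x y, (x, y) ∈ S →
    M.OutputsIn (pair x y) (F x y) (polylog K k (size x y))

/-! ### NC -/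

/-- The gates of a Boolean circuit; `inp j` is the `j`-th input bit, and the arguments of the other
gates are numbers of earlier gates. -/
inductive Gate where
  | inp (j : ℕ)
  | lit (b : Bool)
  | neg (i : ℕ)
  | conj (i j : ℕ)
  | disj (i j : ℕ)

/-- The value of a gate on the input `x`, from the values `vs` of the earlier gates (a number that
refers to no earlier gate, or to no input bit, stands for `false`). -/
def Gate.eval (x vs : List Bool) : Gate → Bool
  | Gate.inp j => x.getD j false
  | Gate.lit b => b
  | Gate.neg i => !(vs.getD i false)
  | Gate.conj i j => vs.getD i false && vs.getD j false
  | Gate.disj i j => vs.getD i false || vs.getD j false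

/-- The depth of a gate, from the depths `ds` of the earlier gates. -/
def Gate.depth (ds : List ℕ) : Gate → ℕ
  | Gate.inp _ => 0
  | Gate.lit _ => 0
  | Gate.neg i => ds.getD i 0 + 1
  | Gate.conj i j => max (ds.getD i 0) (ds.getD j 0) + 1
  | Gate.disj i j => max (ds.getD i 0) (ds.getD j 0) + 1

/-- A Boolean circuit: its gates in topological order, and its output positions. Each output
position is given by two gates; the first tells whether the position carries a symbol of the output
string at all (so that outputs of different lengths are possible), the second gives the symbol. -/
structure Circuit where
  gates : List Gate
  outs : List (ℕ × ℕ)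

namespace Circuit

/-- The values of all gates on the input `x`. -/
def vals (G : Circuit) (x : List Bool) : List Bool :=
  G.gates.foldl (fun vs g => vs ++ [g.eval x vs]) []

/-- The depths of all gates. -/
def depths (G : Circuit) : List ℕ :=
  G.gates.foldl (fun ds g => ds ++ [g.depth ds]) []

/-- The depth of the circuit. -/
def depth (G : Circuit) : ℕ := G.depths.foldr max 0

/-- The size of the circuit. -/
def size (G : Circuit) : ℕ := G.gates.length + G.outs.length

/-- The symbol at position `j` of the output string (`none` if there is no such position). -/
def output (G : Circuit) (x : List Bool) (j : ℕ) : Option Bool :=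
  G.outs[j]?.bind fun o =>
    if (G.vals x).getD o.1 false = true then some ((G.vals x).getD o.2 false) else none

end Circuit

/-- The symbols used to describe circuits. -/
inductive CSym where
  | inp
  | tt
  | ff
  | neg
  | conj
  | disj
  | out
  | tick
  | sep

/-- A number in unary. -/
def unary (n : ℕ) : List CSym := List.replicate n CSym.tick

/-- The description of a gate. -/
def Gate.code : Gate → List CSym
  | Gate.inp j => CSym.inp :: unary j
  | Gate.lit true => [CSym.tt]
  | Gate.lit false => [CSym.ff]
  | Gate.neg i => CSym.neg :: unary i
  | Gate.conj i j => CSym.conj :: (unary i ++ CSym.sep :: unary j)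
  | Gate.disj i j => CSym.disj :: (unary i ++ CSym.sep :: unary j)

/-- The description of a circuit. -/
def Circuit.code (G : Circuit) : List CSym :=
  G.gates.flatMap Gate.code ++ G.outs.flatMap fun o => CSym.out :: (unary o.1 ++ CSym.sep :: unary o.2)

/-- A family of circuits is logspace-uniform: an ordinary Turing machine computes the description
of the `n`-th circuit from `n` in unary in logarithmic space (and therefore polynomial time). -/
def LogspaceUniform (G : ℕ → Circuit) : Prop :=
  ∃ (M : RATM Unit CSym) (p : Polynomial ℕ) (K : ℕ), M.Ordinary ∧ ∀ n,
    M.OutputsIn (List.replicate n ()) (G n).code (p.eval n) ∧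
    M.WithinSpace (List.replicate n ()) (K * (Nat.log 2 n + 1))

/-- `f` is NC-computable: it is computed by a logspace-uniform family of Boolean circuits of
bounded fan-in, polynomial size and polylogarithmic depth. -/
def NC (f : List Bool → List Bool) : Prop :=
  ∃ (G : ℕ → Circuit) (p : Polynomial ℕ) (K k : ℕ), LogspaceUniform G ∧
    (∀ n, (G n).size ≤ p.eval n) ∧ (∀ n, (G n).depth ≤ polylog K k n) ∧
    ∀ x j, (f x)[j]? = (G x.length).output x j

/-! ### Optimization problems, approximation, reductions -/

/-- Minimization or maximization. -/
inductive Goal where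
  | min
  | max

/-- An optimization problem. `inst D P` says that `P` is a problem instance defined on the data
`D`; `sol D P` is the set of feasible solutions and `meas D P y` the positive measure of the
feasible solution `y`. Every instance has an optimum solution. -/
structure OptProblem where
  goal : Goal
  inst : List Bool → List Bool → Prop
  sol : List Bool → List Bool → Set (List Bool)
  meas : List Bool → List Bool → List Bool → ℝ
  meas_pos : ∀ D P, inst D P → ∀ y ∈ sol D P, 0 < meas D P y
  exists_opt : ∀ D P, inst D P → ∃ y ∈ sol D P, ∀ z ∈ sol D P,
    match goal with
    | Goal.min => meas D P y ≤ meas D P z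
    | Goal.max => meas D P z ≤ meas D P y

namespace OptProblem

/-- The measure of an optimum solution. -/
noncomputable def opt (Pb : OptProblem) (D P : List Bool) : ℝ :=
  match Pb.goal with
  | Goal.min => sInf (Pb.meas D P '' Pb.sol D P)
  | Goal.max => sSup (Pb.meas D P '' Pb.sol D P)

/-- The approximation ratio of a feasible solution. -/
noncomputable def ratio (Pb : OptProblem) (D P y : List Bool) : ℝ :=
  max (Pb.meas D P y / Pb.opt D P) (Pb.opt D P / Pb.meas D P y)

end OptProblem

/-- The problem has a pseudo-polylog-time `r`-approximation algorithm: after a polynomial-time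
preprocessing `pre` of the data (into a string over some finite alphabet), a random-access Turing
machine finds, for every instance `P` on `D`, a feasible solution of ratio at most `r` in time
polylogarithmic in the length of `D`. -/
def HasPolylogApprox (Pb : OptProblem) (r : ℝ) : Prop :=
  ∃ (Γ : Type) (_ : Finite Γ) (pre : List Bool → List Γ)
    (M : RATM (Option Γ × Option Bool) Bool) (K k : ℕ), PolyTime pre ∧
    ∀ D P, Pb.inst D P → ∃ y ∈ Pb.sol D P,
      M.OutputsIn (pair (pre D) P) y (polylog K k D.length) ∧ Pb.ratio D P y ≤ r

/-- `f₁, f₂, g, h` is a pseudo-polylog-time reduction between optimization problems: `f₁` and `f₂`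
are NC-computable, and `g` and `h` are computable in polylogarithmic time on all pairs to which the
reduction applies them; `g` maps instances to instances and `h` maps feasible solutions back to
feasible solutions. -/
structure IsPolylogReduction (Pb₁ Pb₂ : OptProblem) (f₁ f₂ : List Bool → List Bool)
    (g h : List Bool → List Bool → List Bool) : Prop where
  nc₁ : NC f₁
  nc₂ : NC f₂
  time_g : PolylogTimeOn {q | ∃ D, Pb₁.inst D q.2 ∧ q.1 = f₂ D} (fun x _ => x.length) g
  time_h : PolylogTimeOn
    {q | ∃ D P, Pb₁.inst D P ∧ q.1 = f₂ D ∧ q.2 ∈ Pb₂.sol (f₁ D) (g (f₂ D) P)}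
    (fun x y => x.length + y.length) h
  inst_map : ∀ D P, Pb₁.inst D P → Pb₂.inst (f₁ D) (g (f₂ D) P)
  sol_map : ∀ D P, Pb₁.inst D P → ∀ y ∈ Pb₂.sol (f₁ D) (g (f₂ D) P), h (f₂ D) y ∈ Pb₁.sol D P

/-- Pseudo-polylog-time L-reducibility with parameters `α` and `β`. -/
def LReducible (Pb₁ Pb₂ : OptProblem) (α β : ℝ) : Prop :=
  ∃ (f₁ f₂ : List Bool → List Bool) (g h : List Bool → List Bool → List Bool),
    IsPolylogReduction Pb₁ Pb₂ f₁ f₂ g h ∧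
    ∀ D P, Pb₁.inst D P →
      Pb₂.opt (f₁ D) (g (f₂ D) P) ≤ α * Pb₁.opt D P ∧
      ∀ y ∈ Pb₂.sol (f₁ D) (g (f₂ D) P),
        |Pb₁.opt D P - Pb₁.meas D P (h (f₂ D) y)| ≤
          β * |Pb₂.opt (f₁ D) (g (f₂ D) P) - Pb₂.meas (f₁ D) (g (f₂ D) P) y|

end PsPL

/-! The inequality behind the theorem is short. If `y` solves the image instance with ratio at most
`1 + δ`, its measure differs from `opt₂` by at most `δ * opt₂`, whether the second problem is a
minimization or a maximization problem. The two L-reduction inequalities then give `|opt₁ - τ₁(h y)|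
≤ β * δ * opt₂ ≤ α * β * δ * opt₁`. With `ε = α * β * δ` this means `τ₁ ≤ (1 + ε) * opt₁` for a
minimum, and `τ₁ ≥ (1 - ε) * opt₁`, hence ratio at most `1 / (1 - ε) = 1 + ε / (1 - ε)`, for a
maximum.

Most of the work is algorithmic. The new preprocessing stores `f₂ D` and the preprocessed `f₁ D` on
two tracks; a query computes `g`, runs the given algorithm, and applies `h`
(`HasPolylogApprox.of_reduction`). This rests on three facts.

Machines compose with only linear overhead, the second one also reading the original input
(`exists_comp`). Copying the intermediate output to an input tape is avoided: the output tape of the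
first machine moves in parallel with the input tape and acts as another track of it. The index tapes
must be blank before the second machine starts; since their heads never jump, they can be erased in
time proportional to the time already spent.

NC functions are computable in polynomial time (`NC.polyTime`): generate the circuit from the unary
length of the input, then evaluate it with an explicit machine.

A machine writes at most one cell per tape and step, so outputs are no longer than running times
(`RATM.OutputsIn.length_le`). Hence `f₁ D`, `f₂ D` and the solution found have length polynomial in
`|D|`, and time polylogarithmic in those lengths is polylogarithmic in `|D|` (`exists_polylog_le`).
-/

namespace PsPL

/-! ### Tapes and runs -/

namespace Tape

variable {X Y : Type}

/-- Apply `f` to the symbols on a tape. -/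
def map (f : X → Y) (T : Tape X) : Tape Y where
  cells := fun i => (T.cells i).map f
  head := T.head

theorem write_read (T : Tape X) (m : Move) : T.write T.read m = T.move m := by
  simp [Tape.write, Tape.move, Tape.read]

theorem move_stay (T : Tape X) : T.move Move.stay = T := rfl

theorem map_read (f : X → Y) (T : Tape X) : (T.map f).read = T.read.map f := rfl

theorem map_write (f : X → Y) (T : Tape X) (a : Option X) (m : Move) :
    (T.map f).write (a.map f) m = (T.write a m).map f := by
  simp only [Tape.write, Tape.map, Tape.mk.injEq, and_true]
  funext i
  by_cases h : i = T.head
  · subst h; simp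
  · simp [h]

theorem map_goto (f : X → Y) (T : Tape X) (n : ℕ) : (T.map f).goto n = (T.goto n).map f := rfl

theorem map_ofList_nil (f : X → Y) : (Tape.ofList ([] : List X)).map f = Tape.ofList [] := by
  simp [Tape.ofList, Tape.map]

theorem ext' {S T : Tape X} (h : S.head = T.head) (h' : ∀ i, S.cells i = T.cells i) : S = T := by
  cases S; cases T; simp only [Tape.mk.injEq]; exact ⟨funext h', h⟩

end Tape

theorem Move.apply_le (m : Move) (n : ℕ) : m.apply n ≤ n + 1 := by
  cases m <;> simp [Move.apply] <;> omega

theorem indexValue_nil : indexValue (Tape.ofList ([] : List Bool)).cells = 0 := by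
  have : blockLength (Tape.ofList ([] : List Bool)).cells = 0 := by
    simp [blockLength, Tape.ofList]
  simp [indexValue, this]

namespace RATM

variable {A B : Type}

/-- `M` gets from one configuration to another in exactly `n` steps. -/
inductive Steps (M : RATM A B) : ℕ → M.Cfg → M.Cfg → Prop
  | refl (c) : Steps M 0 c c
  | head {n c d e} : M.step c = some d → Steps M n d e → Steps M (n + 1) c e

theorem Steps.trans {M : RATM A B} {m n : ℕ} {c d e : M.Cfg} (h : M.Steps m c d)
    (h' : M.Steps n d e) : M.Steps (m + n) c e := by
  induction h with
  | refl c => simpa using h'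
  | @head k c d _ hs _ ih =>
    have := Steps.head hs (ih h')
    rwa [show k + 1 + n = k + n + 1 by omega]

theorem Steps.single {M : RATM A B} {c d : M.Cfg} (h : M.step c = some d) : M.Steps 1 c d :=
  Steps.head h (Steps.refl d)

theorem Steps.run_eq {M : RATM A B} {x : List A} {s n : ℕ} {c d : M.Cfg} (h : M.Steps n c d)
    (hc : M.run x s = some c) : M.run x (s + n) = some d := by
  induction h generalizing s with
  | refl c => simpa using hc
  | @head k c d _ hs _ ih =>
    have := ih (s := s + 1) (by simp [run, hc, hs])
    rwa [show s + (k + 1) = s + 1 + k by omega]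

theorem steps_of_run {M : RATM A B} {x : List A} {s : ℕ} {c : M.Cfg} (h : M.run x s = some c) :
    M.Steps s (M.init x) c := by
  induction s generalizing c with
  | zero => simp only [run, Option.some.injEq] at h; subst h; exact Steps.refl _
  | succ s ih =>
    simp only [run, Option.bind_eq_some_iff] at h
    obtain ⟨d, hd, h⟩ := h
    exact (ih hd).trans (Steps.single h)

theorem outputsIn_of_steps {M : RATM A B} {x : List A} {y : List B} {n t : ℕ} {c : M.Cfg}
    (h : M.Steps n (M.init x) c) (hn : n ≤ t) (hc : M.step c = none)
    (hy : ∀ i, (c.work M.out).cells i = y[i]?.map Sum.inl) : M.OutputsIn x y t :=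
  ⟨n, hn, c, by simpa using h.run_eq (s := 0) rfl, hc, hy⟩

theorem OutputsIn.mono {M : RATM A B} {x : List A} {y : List B} {s t : ℕ}
    (h : M.OutputsIn x y s) (hst : s ≤ t) : M.OutputsIn x y t := by
  obtain ⟨n, hn, h⟩ := h
  exact ⟨n, hn.trans hst, h⟩

/-- Every step carries out an action given by the transition function. -/
theorem step_eq_some {M : RATM A B} {c d : M.Cfg} (h : M.step c = some d) :
    ∃ a, M.tr c.state c.input.read (fun t => (c.work t).read) (fun t => (c.idx t).read) = some a ∧
      d = if M.jump a.next = true then M.access (M.act c a) else M.act c a := by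
  simp only [step, Option.map_eq_some_iff] at h
  obtain ⟨a, ha, h⟩ := h
  exact ⟨a, ha, h.symm⟩

theorem step_of_tr {M : RATM A B} {c : M.Cfg} {q : M.Q} {a : Action M.Q (B ⊕ M.E) M.T}
    (hq : c.state = q)
    (h : M.tr q c.input.read (fun t => (c.work t).read) (fun t => (c.idx t).read) = some a) :
    M.step c = some (if M.jump a.next = true then M.access (M.act c a) else M.act c a) := by
  subst hq
  simp only [step, h, Option.map_some]

theorem step_of_tr_of_jump {M : RATM A B} {c : M.Cfg} {q : M.Q} {a : Action M.Q (B ⊕ M.E) M.T}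
    (hq : c.state = q)
    (h : M.tr q c.input.read (fun t => (c.work t).read) (fun t => (c.idx t).read) = some a)
    (hj : M.jump a.next = false) : M.step c = some (M.act c a) := by
  rw [step_of_tr hq h, if_neg (by simp [hj])]

/-- Random access moves only the non-index heads, so index heads advance at most one cell per step
even on a machine that jumps. This bounds the region to be erased between two composed machines. -/
theorem idx_bound {M : RATM A B} {n : ℕ} {x : List A} {c : M.Cfg} (h : M.run x n = some c)
    (t : Option M.T) : (c.idx t).head ≤ n ∧ ∀ i, n ≤ i → (c.idx t).cells i = none := by
  induction n generalizing c with
  | zero => simp only [run, Option.some.injEq] at h; subst h; simp [init, Tape.ofList]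
  | succ n ih =>
    simp only [run, Option.bind_eq_some_iff] at h
    obtain ⟨d, hd, h⟩ := h
    obtain ⟨a, -, rfl⟩ := step_eq_some h
    obtain ⟨h1, h2⟩ := ih hd
    have key : ((M.act d a).idx t).head ≤ n + 1 ∧
        ∀ i, n + 1 ≤ i → ((M.act d a).idx t).cells i = none := by
      refine ⟨(Move.apply_le _ _).trans (by omega), fun i hi => ?_⟩
      simp only [act, Tape.write]
      rw [Function.update_of_ne (by omega)]
      exact h2 i (by omega)
    split
    · exact key
    · exact key

theorem head_bound_of_ordinary {M : RATM A B} (hM : M.Ordinary) {n : ℕ} {x : List A} {c : M.Cfg}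
    (h : M.run x n = some c) : c.input.head ≤ n ∧ ∀ t, (c.work t).head ≤ n := by
  induction n generalizing c with
  | zero => simp only [run, Option.some.injEq] at h; subst h; simp [init, Tape.ofList]
  | succ n ih =>
    simp only [run, Option.bind_eq_some_iff] at h
    obtain ⟨d, hd, h⟩ := h
    obtain ⟨a, -, rfl⟩ := step_eq_some h
    obtain ⟨h1, h2⟩ := ih hd
    rw [if_neg (by simp [hM a.next])]
    exact ⟨(Move.apply_le _ _).trans (by omega),
      fun t => (Move.apply_le _ _).trans (Nat.succ_le_succ (h2 t))⟩

/-- With random access the written cells may be scattered far from cell 0, so they are counted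
rather than located. -/
theorem card_nonblank {M : RATM A B} {n : ℕ} {x : List A} {c : M.Cfg} (h : M.run x n = some c)
    (t : M.T) : ∃ F : Finset ℕ, F.card ≤ n ∧ ∀ i, (c.work t).cells i ≠ none → i ∈ F := by
  induction n generalizing c with
  | zero =>
    simp only [run, Option.some.injEq] at h; subst h
    exact ⟨∅, by simp, by simp [init, Tape.ofList]⟩
  | succ n ih =>
    simp only [run, Option.bind_eq_some_iff] at h
    obtain ⟨d, hd, h⟩ := h
    obtain ⟨a, -, rfl⟩ := step_eq_some h
    obtain ⟨F, hF, hF'⟩ := ih hd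
    refine ⟨insert (d.work t).head F, (Finset.card_insert_le _ _).trans (by omega), fun i hi => ?_⟩
    have hi : ((M.act d a).work t).cells i ≠ none := by
      split at hi
      · exact hi
      · exact hi
    by_cases e : i = (d.work t).head
    · simp [e]
    · refine Finset.mem_insert_of_mem (hF' i ?_)
      simpa [act, Tape.write, e] using hi

/-- The output fills an initial segment of its tape, so its length is at most the number of nonblank
cells. -/
theorem OutputsIn.length_le {M : RATM A B} {x : List A} {y : List B} {t : ℕ}
    (h : M.OutputsIn x y t) : y.length ≤ t := by
  obtain ⟨s, hs, c, hc, -, hy⟩ := h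
  obtain ⟨F, hF, hF'⟩ := card_nonblank hc M.out
  have : Finset.range y.length ⊆ F := fun i hi => hF' i (by
    rw [hy, List.getElem?_eq_getElem (Finset.mem_range.1 hi)]; simp)
  have := Finset.card_le_card this
  rw [Finset.card_range] at this
  omega

end RATM

/-! ### Sequential composition of machines -/

/-- The control states of a sequential composition between the two machines. -/
inductive CompPhase where
  | start
  | back
  | wipe
  | rewind
  | ready

instance : Finite CompPhase := by
  refine Finite.of_injective (β := Fin 5) (fun p => match p with
    | .start => 0 | .back => 1 | .wipe => 2 | .rewind => 3 | .ready => 4) ?_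
  intro a b; cases a <;> cases b <;> simp

section Comp

variable {A A₁ A₂ B₁ B₂ E₁ E₂ : Type}

/-- The symbols of the first machine in the alphabet of a sequential composition. -/
def encFst (s : B₁ ⊕ E₁) : B₂ ⊕ (E₂ ⊕ (B₁ ⊕ E₁)) := Sum.inr (Sum.inr s)

/-- The symbols of the second machine in the alphabet of a sequential composition. -/
def encSnd (s : B₂ ⊕ E₂) : B₂ ⊕ (E₂ ⊕ (B₁ ⊕ E₁)) := Sum.map id Sum.inl s

/-- The inverse of `encFst`. -/
def decFst : B₂ ⊕ (E₂ ⊕ (B₁ ⊕ E₁)) → Option (B₁ ⊕ E₁)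
  | Sum.inr (Sum.inr s) => some s
  | _ => none

/-- The inverse of `encSnd`. -/
def decSnd : B₂ ⊕ (E₂ ⊕ (B₁ ⊕ E₁)) → Option (B₂ ⊕ E₂)
  | Sum.inl b => some (Sum.inl b)
  | Sum.inr (Sum.inl e) => some (Sum.inr e)
  | _ => none

theorem decFst_encFst (s : Option (B₁ ⊕ E₁)) :
    (s.map (encFst : _ → B₂ ⊕ (E₂ ⊕ (B₁ ⊕ E₁)))).bind decFst = s := by
  cases s <;> rfl

theorem decSnd_encSnd (s : Option (B₂ ⊕ E₂)) :
    (s.map (encSnd : _ → B₂ ⊕ (E₂ ⊕ (B₁ ⊕ E₁)))).bind decSnd = s := by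
  rcases s with _ | _ | _ <;> rfl

/-- Keep all tapes as they are, except that the heads of the input and work tapes move by `m` and
the index tapes are changed by `f`. -/
def CompPhase.action {Q X T : Type} (q : Q) (w : T → Option X) (m : Move)
    (f : Option T → Option Bool × Move) : Action Q X T where
  next := q
  inp := m
  work := fun t => (w t, m)
  idx := f

/-- Run `M₁` on the input seen through `φ₁`, then clean up, then run `M₂` on the input and the
output of `M₁` seen through `φ₂`. The index tape of the additional work tape `none` counts the
steps of `M₁`. The flag `b` tells whether the clean-up ends with a random access. -/
abbrev RATM.comp [Finite B₁] (M₁ : RATM A₁ B₁) (M₂ : RATM A₂ B₂) (φ₁ : Option A → Option A₁)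
    (φ₂ : Option A → Option B₁ → Option A₂) (b : Bool) : RATM A B₂ where
  Q := M₁.Q ⊕ (M₂.Q ⊕ CompPhase)
  E := M₂.E ⊕ (B₁ ⊕ M₁.E)
  T := Option (M₁.T ⊕ M₂.T)
  finQ := by
    have := M₁.finQ; have := M₂.finQ; infer_instance
  finE := by
    have := M₁.finE; have := M₂.finE; infer_instance
  finT := by
    have := M₁.finT; have := M₂.finT; infer_instance
  out := some (Sum.inr M₂.out)
  start := Sum.inr (Sum.inr CompPhase.start)
  jump
    | Sum.inl q => M₁.jump q
    | Sum.inr (Sum.inl q) => M₂.jump q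
    | Sum.inr (Sum.inr CompPhase.ready) => b
    | _ => false
  tr
    | Sum.inr (Sum.inr CompPhase.start), _, w, i =>
      some <| CompPhase.action (Sum.inl M₁.start) w Move.stay fun
        -- The mark in cell 0 of the clock, by which `back` and `rewind` recognise the left end.
        | some none => (some false, Move.right)
        | t => (i t, Move.stay)
    | Sum.inl q, a, w, i =>
      match M₁.tr q (φ₁ a) (fun t => (w (some (Sum.inl t))).bind decFst)
          (fun t => i (t.map fun t => some (Sum.inl t))) with
      | some c => some
        { next := Sum.inl c.next
          inp := c.inp
          work := fun
            | some (Sum.inl t) => ((c.work t).1.map encFst, (c.work t).2)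
            | t => (w t, Move.stay)
          idx := fun
            | none => c.idx none
            | some none => (some true, Move.right)
            | some (some (Sum.inl t)) => c.idx (some t)
            | some (some (Sum.inr t)) => (i (some (some (Sum.inr t))), Move.stay) }
      | none => some <| CompPhase.action (Sum.inr (Sum.inr CompPhase.back)) w Move.stay
          fun t => (i t, Move.stay)
    | Sum.inr (Sum.inr CompPhase.back), _, w, i => some <|
      if i (some none) = some false then
        CompPhase.action (Sum.inr (Sum.inr CompPhase.wipe)) w Move.stay fun t => (i t, Move.stay)
      else CompPhase.action (Sum.inr (Sum.inr CompPhase.back)) w Move.left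
        fun t => (i t, Move.left)
    | Sum.inr (Sum.inr CompPhase.wipe), _, w, i => some <|
      if i (some none) = none then
        CompPhase.action (Sum.inr (Sum.inr CompPhase.rewind)) w Move.stay fun t => (i t, Move.stay)
      else CompPhase.action (Sum.inr (Sum.inr CompPhase.wipe)) w Move.stay fun
        | some none => (i (some none), Move.right)
        | _ => (none, Move.right)
    | Sum.inr (Sum.inr CompPhase.rewind), _, w, i => some <|
      if i (some none) = some false then
        CompPhase.action (Sum.inr (Sum.inr CompPhase.ready)) w Move.stay fun t => (i t, Move.stay)
      else CompPhase.action (Sum.inr (Sum.inr CompPhase.rewind)) w Move.stay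
        fun t => (i t, Move.left)
    | Sum.inr (Sum.inr CompPhase.ready), _, w, i =>
      some <| CompPhase.action (Sum.inr (Sum.inl M₂.start)) w Move.stay fun t => (i t, Move.stay)
    | Sum.inr (Sum.inl q), a, w, i =>
      (M₂.tr q (φ₂ a (((w (some (Sum.inl M₁.out))).bind decFst).bind Sum.getLeft?))
          (fun t => (w (some (Sum.inr t))).bind decSnd)
          (fun t => i (t.map fun t => some (Sum.inr t)))).map fun c =>
        { next := Sum.inr (Sum.inl c.next)
          inp := c.inp
          work := fun
            | some (Sum.inr t) => ((c.work t).1.map encSnd, (c.work t).2)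
            -- The tapes of `M₁` follow the input head; below they also receive a copy of the
            -- input's index tape, so that they follow it through random accesses too.
            | some (Sum.inl t) => (w (some (Sum.inl t)), c.inp)
            | none => (w none, Move.stay)
          idx := fun
            | some none => (i (some none), Move.stay)
            | some (some (Sum.inr t)) => c.idx (some t)
            | none => c.idx none
            | some (some (Sum.inl _)) => c.idx none }

theorem RATM.comp_ordinary [Finite B₁] {M₁ : RATM A₁ B₁} {M₂ : RATM A₂ B₂}
    (h₁ : M₁.Ordinary) (h₂ : M₂.Ordinary) (φ₁ : Option A → Option A₁)
    (φ₂ : Option A → Option B₁ → Option A₂) : (M₁.comp M₂ φ₁ φ₂ false).Ordinary := by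
  rintro (q | q | q)
  · exact h₁ q
  · exact h₂ q
  · cases q <;> rfl

/-- The tape that counts steps, with the head on cell `k`, after `n` steps. -/
def clockTape (n k : ℕ) : Tape Bool where
  cells := fun i => if i = 0 then some false else if i < n then some true else none
  head := k

/-! ### Simulation of the first machine -/

variable [Finite B₁] {M₁ : RATM A₁ B₁} {M₂ : RATM A₂ B₂} {φ₁ : Option A → Option A₁}
  {φ₂ : Option A → Option B₁ → Option A₂} {b : Bool}

/-- How a configuration of the composition represents a configuration of the first machine. -/
structure SimFst (s : ℕ) (x : List A) (x₁ : List A₁) (c : M₁.Cfg)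
    (C : (M₁.comp M₂ φ₁ φ₂ b).Cfg) : Prop where
  state : C.state = Sum.inl c.state
  input : C.input = (Tape.ofList x).goto c.input.head
  input₁ : c.input = (Tape.ofList x₁).goto c.input.head
  fst : ∀ t, C.work (some (Sum.inl t)) = (c.work t).map encFst
  snd : ∀ t, C.work (some (Sum.inr t)) = Tape.ofList []
  idx : C.idx none = c.idx none
  idx_fst : ∀ t, C.idx (some (some (Sum.inl t))) = c.idx (some t)
  idx_snd : ∀ t, C.idx (some (some (Sum.inr t))) = Tape.ofList []
  clock : C.idx (some none) = clockTape (s + 1) (s + 1)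

theorem clockTape_write (n : ℕ) : (clockTape (n + 1) (n + 1)).write (some true) Move.right =
    clockTape (n + 2) (n + 2) := by
  refine Tape.ext' rfl fun i => ?_
  simp only [Tape.write, clockTape, Function.update_apply]
  grind

theorem SimFst.init (x : List A) (x₁ : List A₁) :
    ∃ C, (M₁.comp M₂ φ₁ φ₂ b).run x 1 = some C ∧ SimFst 0 x x₁ (M₁.init x₁) C := by
  have hn : ∀ {X : Type} (m : Move), m ≠ Move.right →
      (Tape.ofList ([] : List X)).write (Tape.ofList ([] : List X)).read m = Tape.ofList [] := by
    intro X m hm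
    rw [Tape.write_read]
    cases m
    · rfl
    · rfl
    · exact absurd rfl hm
  have hc : (Tape.ofList ([] : List Bool)).write (some false) Move.right = clockTape 1 1 := by
    refine Tape.ext' rfl fun i => ?_
    simp only [Tape.write, clockTape, Tape.ofList, Function.update_apply]
    grind
  have h1 : Move.stay ≠ Move.right := by simp
  refine ⟨_, RATM.step_of_tr (M := M₁.comp M₂ φ₁ φ₂ b) (c := RATM.init _ x) rfl rfl, ?_⟩
  -- The start state of `M₁` may itself be a jump state; the access is harmless, as the index tapes
  -- used in the simulation are still blank and describe cell 0.
  split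
  · constructor <;> intros <;>
      simp only [RATM.access, RATM.act, CompPhase.action, RATM.init, hn _ h1, hc,
        indexValue_nil] <;> rfl
  · constructor <;> intros <;>
      simp only [RATM.act, CompPhase.action, RATM.init, hn _ h1, hc] <;> rfl

/-- `φ₁` translates the input cell by cell, blanks included, so head positions and random-access
addresses are the same on both sides. -/
theorem SimFst.step {s : ℕ} {x : List A} {x₁ : List A₁} {c d : M₁.Cfg}
    {C : (M₁.comp M₂ φ₁ φ₂ b).Cfg} (hx : ∀ i : ℕ, φ₁ x[i]? = x₁[i]?) (h : SimFst s x x₁ c C)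
    (hd : M₁.step c = some d) :
    ∃ D, (M₁.comp M₂ φ₁ φ₂ b).step C = some D ∧ SimFst (s + 1) x x₁ d D := by
  obtain ⟨a, ha, rfl⟩ := RATM.step_eq_some hd
  have e1 : φ₁ C.input.read = c.input.read := by
    rw [h.input, h.input₁]; exact hx _
  have e2 : (fun t => (C.work (some (Sum.inl t))).read.bind decFst) =
      fun t => (c.work t).read := by
    funext t; rw [h.fst, Tape.map_read, decFst_encFst]
  have e3 : (fun t : Option M₁.T => (C.idx (t.map fun t => some (Sum.inl t))).read) =
      fun t => (c.idx t).read := by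
    funext t; cases t
    · exact congrArg Tape.read h.idx
    · exact congrArg Tape.read (h.idx_fst _)
  have hn : ∀ {X : Type} (T : Tape X), T.write T.read Move.stay = T := fun T =>
    (Tape.write_read T _).trans (Tape.move_stay T)
  have ht := ha
  rw [← e1, ← e2, ← e3] at ht
  refine ⟨_, RATM.step_of_tr h.state (by simp only [ht]; rfl), ?_⟩
  by_cases hj : M₁.jump a.next = true
  · simp only [hj, if_true]
    constructor
    · rfl
    · simp only [RATM.access, RATM.act, h.idx, h.input]; rfl
    · simp only [RATM.access, RATM.act]; rw [h.input₁]; rfl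
    · intro t
      simp only [RATM.access, RATM.act, h.idx_fst, h.fst, Tape.map_write, Tape.map_goto]
    · intro t
      simp only [RATM.access, RATM.act, hn, h.snd, h.idx_snd, indexValue_nil]; rfl
    · simp only [RATM.access, RATM.act, h.idx]
    · intro t; simp only [RATM.access, RATM.act, h.idx_fst]
    · intro t; simp only [RATM.access, RATM.act, hn, h.idx_snd]
    · simp only [RATM.access, RATM.act, h.clock, clockTape_write]
  · simp only [hj, Bool.false_eq_true, if_false]
    constructor
    · rfl
    · simp only [RATM.act, h.input]; rfl
    · simp only [RATM.act]; rw [h.input₁]; rfl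
    · intro t
      simp only [RATM.act, h.fst, Tape.map_write]
    · intro t
      simp only [RATM.act, hn, h.snd]
    · simp only [RATM.act, h.idx]
    · intro t; simp only [RATM.act, h.idx_fst]
    · intro t; simp only [RATM.act, hn, h.idx_snd]
    · simp only [RATM.act, h.clock, clockTape_write]

theorem SimFst.run {x : List A} {x₁ : List A₁} (hx : ∀ i : ℕ, φ₁ x[i]? = x₁[i]?) {s : ℕ}
    {c : M₁.Cfg} (hc : M₁.run x₁ s = some c) :
    ∃ C, (M₁.comp M₂ φ₁ φ₂ b).run x (s + 1) = some C ∧ SimFst s x x₁ c C := by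
  induction s generalizing c with
  | zero =>
    simp only [RATM.run, Option.some.injEq] at hc; subst hc; exact SimFst.init x x₁
  | succ s ih =>
    simp only [RATM.run, Option.bind_eq_some_iff] at hc
    obtain ⟨d, hd, h⟩ := hc
    obtain ⟨C, hC, hS⟩ := ih hd
    obtain ⟨D, hD, hS'⟩ := hS.step hx h
    exact ⟨D, by rw [RATM.run, hC]; exact hD, hS'⟩

/-! ### Clean-up between the two machines -/

theorem clockTape_read (n k : ℕ) : (clockTape n k).read = some false ↔ k = 0 := by
  simp only [Tape.read, clockTape]
  grind

theorem clockTape_read_none (n k : ℕ) : (clockTape n k).read = none ↔ k ≠ 0 ∧ n ≤ k := by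
  simp only [Tape.read, clockTape]
  grind

/-- The control state of a sequential composition in the phase `p`. -/
abbrev compState (M₁ : RATM A₁ B₁) (M₂ : RATM A₂ B₂) (φ₁ : Option A → Option A₁)
    (φ₂ : Option A → Option B₁ → Option A₂) (b : Bool) (p : CompPhase) :
    (M₁.comp M₂ φ₁ φ₂ b).Q := Sum.inr (Sum.inr p)

/-- All heads move left together until the clock reaches its mark. The truncated subtraction
reflects that a head already at cell 0 stays there. -/
theorem comp_back {n k : ℕ} {C : (M₁.comp M₂ φ₁ φ₂ b).Cfg}
    (hs : C.state = compState M₁ M₂ φ₁ φ₂ b .back) (hc : C.idx (some none) = clockTape n k) :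
    ∃ D, (M₁.comp M₂ φ₁ φ₂ b).Steps (k + 1) C D ∧ D.state = compState M₁ M₂ φ₁ φ₂ b .wipe ∧
      D.input = C.input.goto (C.input.head - k) ∧
      (∀ t, D.work t = (C.work t).goto ((C.work t).head - k)) ∧
      ∀ t, D.idx t = (C.idx t).goto ((C.idx t).head - k) := by
  induction k generalizing C with
  | zero =>
    refine ⟨_, RATM.Steps.single (RATM.step_of_tr_of_jump
      hs (congrArg some (if_pos (show (C.idx (some none)).read = _ by rw [hc, clockTape_read]))) rfl), rfl, rfl, ?_, ?_⟩ <;> intro t <;>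
      simp only [RATM.act, CompPhase.action, Tape.write_read] <;> rfl
  | succ k ih =>
    have h1 := RATM.step_of_tr_of_jump (M := M₁.comp M₂ φ₁ φ₂ b) (c := C)
      hs (congrArg some (if_neg (show ¬(C.idx (some none)).read = _ by rw [hc, clockTape_read]; omega))) rfl
    simp only [RATM.act, CompPhase.action, Tape.write_read] at h1
    obtain ⟨D, hD, e1, e2, e3, e4⟩ := ih (C := ⟨compState M₁ M₂ φ₁ φ₂ b .back,
      C.input.move .left, fun t => (C.work t).move .left, fun t => (C.idx t).move .left⟩) rfl
      (congrArg (Tape.move · .left) hc)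
    refine ⟨D, RATM.Steps.head h1 hD, e1, ?_, fun t => ?_, fun t => ?_⟩
    · rw [e2]; simp only [Tape.move, Tape.goto, Move.apply]; congr 1; omega
    · rw [e3]; simp only [Tape.move, Tape.goto, Move.apply]; congr 1; omega
    · rw [e4]; simp only [Tape.move, Tape.goto, Move.apply]; congr 1; omega

/-- The last step is kept apart because entering `ready` triggers the random access exactly when `b`
is true; `D'` is the configuration before that access. -/
theorem comp_rewind {n k : ℕ} {C : (M₁.comp M₂ φ₁ φ₂ b).Cfg}
    (hs : C.state = compState M₁ M₂ φ₁ φ₂ b .rewind) (hc : C.idx (some none) = clockTape n k) :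
    ∃ D D', (M₁.comp M₂ φ₁ φ₂ b).Steps k C D ∧
      (M₁.comp M₂ φ₁ φ₂ b).step D = some (if b = true then (M₁.comp M₂ φ₁ φ₂ b).access D' else D') ∧
      D'.state = compState M₁ M₂ φ₁ φ₂ b .ready ∧
      D'.input = C.input ∧ (∀ t, D'.work t = C.work t) ∧
      ∀ t, D'.idx t = (C.idx t).goto ((C.idx t).head - k) := by
  induction k generalizing C with
  | zero =>
    refine ⟨C, _, RATM.Steps.refl C, RATM.step_of_tr
      hs (congrArg some (if_pos (show (C.idx (some none)).read = _ by rw [hc, clockTape_read]))), rfl, rfl, ?_, ?_⟩ <;> intro t <;>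
      simp only [RATM.act, CompPhase.action, Tape.write_read] <;> rfl
  | succ k ih =>
    have h1 := RATM.step_of_tr_of_jump (M := M₁.comp M₂ φ₁ φ₂ b) (c := C)
      hs (congrArg some (if_neg (show ¬(C.idx (some none)).read = _ by rw [hc, clockTape_read]; omega))) rfl
    simp only [RATM.act, CompPhase.action, Tape.write_read] at h1
    obtain ⟨D, D', hD, e0, e1, e2, e3, e4⟩ := ih (C := ⟨compState M₁ M₂ φ₁ φ₂ b .rewind,
      C.input.move .stay, fun t => (C.work t).move .stay, fun t => (C.idx t).move .left⟩) rfl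
      (congrArg (Tape.move · .left) hc)
    refine ⟨D, D', RATM.Steps.head h1 hD, e0, e1, ?_, fun t => ?_, fun t => ?_⟩
    · rw [e2]; rfl
    · rw [e3]; rfl
    · rw [e4]; simp only [Tape.move, Tape.goto, Move.apply]; congr 1; omega

/-- The clock serves as a ruler: its first blank, in cell `n`, shows where erasing may stop. Cell 0
of the clock always carries the mark, whence `n ≠ 0`. -/
theorem comp_wipe {n d k : ℕ} {C : (M₁.comp M₂ φ₁ φ₂ b).Cfg} (hn : k + d = n) (hn' : n ≠ 0)
    (hs : C.state = compState M₁ M₂ φ₁ φ₂ b .wipe) (hc : C.idx (some none) = clockTape n k)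
    (hk : ∀ t, (C.idx t).head = k) :
    ∃ D, (M₁.comp M₂ φ₁ φ₂ b).Steps (d + 1) C D ∧ D.state = compState M₁ M₂ φ₁ φ₂ b .rewind ∧
      D.input = C.input ∧ (∀ t, D.work t = C.work t) ∧ D.idx (some none) = clockTape n n ∧
      ∀ t, t ≠ some none → (D.idx t).head = n ∧
        ∀ i, (D.idx t).cells i = if k ≤ i ∧ i < n then none else (C.idx t).cells i := by
  induction d generalizing C k with
  | zero =>
    obtain rfl : k = n := by omega
    have : (clockTape k k).read = none := (clockTape_read_none k k).2 ⟨hn', le_rfl⟩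
    refine ⟨_, RATM.Steps.single (RATM.step_of_tr_of_jump
      hs (congrArg some (if_pos (show (C.idx (some none)).read = _ by rw [hc, this]))) rfl), rfl, rfl, ?_, ?_, ?_⟩
    · intro t; simp only [RATM.act, CompPhase.action, Tape.write_read]; rfl
    · simp only [RATM.act, CompPhase.action, Tape.write_read]; exact hc
    · intro t _
      simp only [RATM.act, CompPhase.action, Tape.write_read]
      refine ⟨hk t, fun i => ?_⟩
      rw [if_neg (by omega)]; rfl
  | succ d ih =>
    have h0 : ¬ (clockTape n k).read = none := by rw [clockTape_read_none]; omega
    have h1 := RATM.step_of_tr_of_jump (M := M₁.comp M₂ φ₁ φ₂ b) (c := C)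
      hs (congrArg some (if_neg (show ¬(C.idx (some none)).read = _ by rw [hc]; exact h0))) rfl
    generalize hC' : RATM.act _ C _ = C' at h1
    have hc' : C'.idx (some none) = clockTape n (k + 1) := by
      rw [← hC']; simp only [RATM.act, CompPhase.action, Tape.write_read]; rw [hc]; rfl
    have hk' : ∀ t, (C'.idx t).head = k + 1 := by
      intro t
      rw [← hC']
      simp only [RATM.act, CompPhase.action, Tape.write, hk]
      rcases t with _ | _ | t <;> rfl
    have hcell : ∀ t, t ≠ some none → ∀ i, (C'.idx t).cells i =
        if i = k then none else (C.idx t).cells i := by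
      intro t ht i
      rw [← hC']
      rcases t with _ | _ | t
      · simp [RATM.act, CompPhase.action, Tape.write, Function.update_apply, hk]
      · exact absurd rfl ht
      · simp [RATM.act, CompPhase.action, Tape.write, Function.update_apply, hk]
    have hw : ∀ t, C'.work t = C.work t := by
      intro t; rw [← hC']; simp only [RATM.act, CompPhase.action, Tape.write_read]; rfl
    obtain ⟨D, hD, e1, e2, e3, e4, e5⟩ := ih (k := k + 1) (by omega) (by rw [← hC']; rfl) hc' hk'
    refine ⟨D, RATM.Steps.head h1 hD, e1, by rw [e2, ← hC']; rfl, fun t => by rw [e3, hw], e4,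
      fun t ht => ⟨(e5 t ht).1, fun i => ?_⟩⟩
    rw [(e5 t ht).2, hcell t ht]
    grind

/-- After the first machine has halted, the composition reaches, in a time proportional to the time
of the first machine, a configuration ready for the second machine. -/
theorem comp_ready {x : List A} {x₁ : List A₁} (hx : ∀ i : ℕ, φ₁ x[i]? = x₁[i]?)
    (hb : b = true ∨ M₁.Ordinary) {s : ℕ} {c : M₁.Cfg}
    (hc : M₁.run x₁ s = some c) (hh : M₁.step c = none) :
    ∃ C, (M₁.comp M₂ φ₁ φ₂ b).Steps (4 * s + 8) ((M₁.comp M₂ φ₁ φ₂ b).init x) C ∧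
      C.state = compState M₁ M₂ φ₁ φ₂ b .ready ∧ C.input = Tape.ofList x ∧
      (∀ t, C.work (some (Sum.inl t)) = ((c.work t).map encFst).goto 0) ∧
      (∀ t, C.work (some (Sum.inr t)) = Tape.ofList []) ∧
      ∀ t, t ≠ some none → C.idx t = Tape.ofList [] := by
  obtain ⟨C₀, hC₀, h⟩ := SimFst.run (M₂ := M₂) (φ₂ := φ₂) (b := b) hx hc
  have S₀ := RATM.steps_of_run hC₀
  have e1 : φ₁ C₀.input.read = c.input.read := by
    rw [h.input, h.input₁]; exact hx _
  have e2 : (fun t => (C₀.work (some (Sum.inl t))).read.bind decFst) =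
      fun t => (c.work t).read := by
    funext t; rw [h.fst, Tape.map_read, decFst_encFst]
  have e3 : (fun t : Option M₁.T => (C₀.idx (t.map fun t => some (Sum.inl t))).read) =
      fun t => (c.idx t).read := by
    funext t; cases t
    · exact congrArg Tape.read h.idx
    · exact congrArg Tape.read (h.idx_fst _)
  have ht : M₁.tr c.state c.input.read (fun t => (c.work t).read) (fun t => (c.idx t).read) =
      none := by simpa [RATM.step] using hh
  rw [← e1, ← e2, ← e3] at ht
  have h1 := RATM.step_of_tr_of_jump (M := M₁.comp M₂ φ₁ φ₂ b) (c := C₀) h.state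
    (by simp only [ht]; rfl) rfl
  generalize hC₁ : RATM.act _ C₀ _ = C₁ at h1
  have i1 : C₁.input = C₀.input := by rw [← hC₁]; rfl
  have w1 : ∀ t, C₁.work t = C₀.work t := by
    intro t; rw [← hC₁]; simp only [RATM.act, CompPhase.action, Tape.write_read]; rfl
  have d1 : ∀ t, C₁.idx t = C₀.idx t := by
    intro t; rw [← hC₁]; simp only [RATM.act, CompPhase.action, Tape.write_read]; rfl
  have bd : ∀ t, t ≠ some none → (C₀.idx t).head ≤ s ∧ ∀ i, s ≤ i → (C₀.idx t).cells i = none := by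
    rintro (_ | _ | t | t) h'
    · rw [h.idx]; exact RATM.idx_bound hc _
    · exact absurd rfl h'
    · rw [h.idx_fst]; exact RATM.idx_bound hc _
    · rw [h.idx_snd]; simp [Tape.ofList]
  obtain ⟨C₂, S₂, s2, i2, w2, d2⟩ := comp_back (C := C₁) (n := s + 1) (k := s + 1)
    (by rw [← hC₁]; rfl) ((d1 _).trans h.clock)
  have h2 : ∀ t, (C₂.idx t).head = 0 := by
    intro t
    rw [d2, d1]
    by_cases ht : t = some none
    · subst ht; rw [h.clock]; exact Nat.sub_self _
    · have := (bd t ht).1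
      simp only [Tape.goto]; omega
  obtain ⟨C₃, S₃, s3, i3, w3, c3, d3⟩ := comp_wipe (C := C₂) (n := s + 1) (d := s + 1) (k := 0)
    (by omega) (by omega) s2 (by rw [d2, d1, h.clock]; simp [Tape.goto, clockTape]) h2
  obtain ⟨C₄, C₅, S₄, S₅, s5, i5, w5, d5⟩ := comp_rewind (C := C₃) s3 c3
  have d5' : ∀ t, t ≠ some none → C₅.idx t = Tape.ofList [] := by
    intro t ht
    rw [d5]
    refine Tape.ext' ?_ fun i => ?_
    · simp [Tape.goto, (d3 t ht).1, Tape.ofList]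
    · have h3 : (C₂.idx t).cells i = (C₀.idx t).cells i := by rw [d2, d1]; rfl
      have h4 := (bd t ht).2 i
      have : (C₃.idx t).cells i = none := by
        rw [(d3 t ht).2, h3]
        split
        · rfl
        · exact h4 (by omega)
      simpa [Tape.goto, Tape.ofList] using this
  have w5' : ∀ t, C₅.work t = (C₀.work t).goto ((C₀.work t).head - (s + 1)) := by
    intro t; rw [w5, w3, w2, w1]
  have i5' : C₅.input = C₀.input.goto (C₀.input.head - (s + 1)) := by rw [i5, i3, i2, i1]
  refine ⟨if b = true then (M₁.comp M₂ φ₁ φ₂ b).access C₅ else C₅, ?_, ?_⟩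
  -- The start and the run of `M₁` take `s + 1` steps, leaving it 1, and each of going back, wiping,
  -- and rewinding into `ready` takes `s + 2`.
  · have := ((((S₀.trans (RATM.Steps.single h1)).trans S₂).trans S₃).trans S₄).trans
      (RATM.Steps.single S₅)
    rwa [show s + 1 + 1 + (s + 1 + 1) + (s + 1 + 1) + (s + 1) + 1 = 4 * s + 8 by omega] at this
  -- With `b` true, the access through blank index tapes sends the input head and the heads of the
  -- work tapes of both machines to cell 0, however far away they are.
  by_cases hb' : b = true
  · rw [if_pos hb']
    refine ⟨s5, ?_, fun t => ?_, fun t => ?_, fun t ht => d5' t ht⟩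
    · simp only [RATM.access, d5' none (by simp), indexValue_nil]
      rw [i5', h.input]; rfl
    · simp only [RATM.access, d5' (some (some (Sum.inl t))) (by simp), indexValue_nil]
      rw [w5', h.fst]; rfl
    · simp only [RATM.access, d5' (some (some (Sum.inr t))) (by simp), indexValue_nil]
      rw [w5', h.snd]; rfl
  · rw [if_neg hb']
    -- Without jumps the heads are within `s` cells of the left end, so the walk back has already
    -- brought them to cell 0.
    have hM := hb.resolve_left hb'
    obtain ⟨b1, b2⟩ := RATM.head_bound_of_ordinary hM hc
    refine ⟨s5, ?_, fun t => ?_, fun t => ?_, fun t ht => d5' t ht⟩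
    · rw [i5', h.input]
      simp only [Tape.goto, Tape.ofList, Tape.mk.injEq, true_and]; omega
    · rw [w5', h.fst]
      have := b2 t
      simp only [Tape.goto, Tape.map, Tape.mk.injEq, true_and]; omega
    · rw [w5', h.snd]; simp [Tape.goto, Tape.ofList]

/-- How a configuration of the composition represents a configuration of the second machine. -/
structure SimSnd (x : List A) (z : List B₁) (x₂ : List A₂) (c : M₂.Cfg)
    (C : (M₁.comp M₂ φ₁ φ₂ b).Cfg) : Prop where
  state : C.state = Sum.inr (Sum.inl c.state)
  input : C.input = (Tape.ofList x).goto c.input.head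
  input₂ : c.input = (Tape.ofList x₂).goto c.input.head
  fst : C.work (some (Sum.inl M₁.out)) =
    ((Tape.ofList z).map (encFst ∘ Sum.inl)).goto c.input.head
  snd : ∀ t, C.work (some (Sum.inr t)) = (c.work t).map encSnd
  idx : C.idx none = c.idx none
  idx_fst : C.idx (some (some (Sum.inl M₁.out))) = c.idx none
  idx_snd : ∀ t, C.idx (some (some (Sum.inr t))) = c.idx (some t)

/-! ### Simulation of the second machine -/

theorem SimSnd.init {x : List A} {z : List B₁} (x₂ : List A₂) {c : M₁.Cfg}
    {C : (M₁.comp M₂ φ₁ φ₂ b).Cfg} (hz : ∀ i, (c.work M₁.out).cells i = z[i]?.map Sum.inl)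
    (hs : C.state = compState M₁ M₂ φ₁ φ₂ b .ready) (hi : C.input = Tape.ofList x)
    (hw₁ : ∀ t, C.work (some (Sum.inl t)) = ((c.work t).map encFst).goto 0)
    (hw₂ : ∀ t, C.work (some (Sum.inr t)) = Tape.ofList [])
    (hd : ∀ t, t ≠ some none → C.idx t = Tape.ofList []) :
    ∃ D, (M₁.comp M₂ φ₁ φ₂ b).step C = some D ∧ SimSnd x z x₂ (M₂.init x₂) D := by
  have hz' : ((c.work M₁.out).map (encFst : _ → B₂ ⊕ (M₂.E ⊕ (B₁ ⊕ M₁.E)))).goto 0 =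
      ((Tape.ofList z).map (encFst ∘ Sum.inl)).goto 0 := by
    refine Tape.ext' rfl fun i => ?_
    simp [Tape.goto, Tape.map, hz, Tape.ofList]
  have hn : ∀ {X : Type} (T : Tape X), T.write T.read Move.stay = T := fun T =>
    (Tape.write_read T _).trans (Tape.move_stay T)
  refine ⟨_, RATM.step_of_tr (M := M₁.comp M₂ φ₁ φ₂ b) hs rfl, ?_⟩
  have d1 := hd none (by simp)
  have d2 := fun t => hd (some (some t)) (by simp)
  split
  · constructor
    · rfl
    · simp only [RATM.access, RATM.act, CompPhase.action, hn, hi, d1, indexValue_nil]; rfl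
    · rfl
    · simp only [RATM.access, RATM.act, CompPhase.action, hn, hw₁, hz', d2, indexValue_nil]; rfl
    · intro t
      simp only [RATM.access, RATM.act, CompPhase.action, hn, hw₂, d2, indexValue_nil, RATM.init,
        Tape.map_ofList_nil]; rfl
    · simp only [RATM.access, RATM.act, CompPhase.action, hn, d1]; rfl
    · simp only [RATM.access, RATM.act, CompPhase.action, hn, d2]; rfl
    · intro t
      simp only [RATM.access, RATM.act, CompPhase.action, hn, d2]; rfl
  · constructor
    · rfl
    · simp only [RATM.act, CompPhase.action, hi]; rfl
    · rfl
    · simp only [RATM.act, CompPhase.action, hn, hw₁, hz']; rfl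
    · intro t
      simp only [RATM.act, CompPhase.action, hn, hw₂, RATM.init, Tape.map_ofList_nil]
    · simp only [RATM.act, CompPhase.action, hn, d1]; rfl
    · simp only [RATM.act, CompPhase.action, hn, d2]; rfl
    · intro t
      simp only [RATM.act, CompPhase.action, hn, d2]; rfl

/-- Stated for the transition function rather than for steps, so that it yields both the simulation
of a step and the halting of the composition together with `M₂`. -/
theorem SimSnd.tr {x : List A} {z : List B₁} {x₂ : List A₂} {c : M₂.Cfg}
    {C : (M₁.comp M₂ φ₁ φ₂ b).Cfg} (hx : ∀ i : ℕ, φ₂ x[i]? z[i]? = x₂[i]?)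
    (h : SimSnd x z x₂ c C) :
    M₂.tr c.state (φ₂ C.input.read
        (((C.work (some (Sum.inl M₁.out))).read.bind decFst).bind Sum.getLeft?))
      (fun t => (C.work (some (Sum.inr t))).read.bind decSnd)
      (fun t => (C.idx (t.map fun t => some (Sum.inr t))).read) =
    M₂.tr c.state c.input.read (fun t => (c.work t).read) (fun t => (c.idx t).read) := by
  have e1 : φ₂ C.input.read
      (((C.work (some (Sum.inl M₁.out))).read.bind decFst).bind Sum.getLeft?) = c.input.read := by
    have : (((C.work (some (Sum.inl M₁.out))).read.bind decFst).bind Sum.getLeft?) =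
        z[c.input.head]? := by
      rw [h.fst]
      simp only [Tape.goto, Tape.read, Tape.map, Tape.ofList]
      cases z[c.input.head]? <;> rfl
    rw [this, h.input, h.input₂]; exact hx _
  have e2 : (fun t => (C.work (some (Sum.inr t))).read.bind decSnd) =
      fun t => (c.work t).read := by
    funext t; rw [h.snd, Tape.map_read, decSnd_encSnd]
  have e3 : (fun t : Option M₂.T => (C.idx (t.map fun t => some (Sum.inr t))).read) =
      fun t => (c.idx t).read := by
    funext t; cases t
    · exact congrArg Tape.read h.idx
    · exact congrArg Tape.read (h.idx_snd _)
  rw [e1, e2, e3]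

theorem SimSnd.step {x : List A} {z : List B₁} {x₂ : List A₂} {c d : M₂.Cfg}
    {C : (M₁.comp M₂ φ₁ φ₂ b).Cfg} (hx : ∀ i : ℕ, φ₂ x[i]? z[i]? = x₂[i]?)
    (h : SimSnd x z x₂ c C) (hd : M₂.step c = some d) :
    ∃ D, (M₁.comp M₂ φ₁ φ₂ b).step C = some D ∧ SimSnd x z x₂ d D := by
  obtain ⟨a, ha, rfl⟩ := RATM.step_eq_some hd
  have ht := (h.tr hx).trans ha
  refine ⟨_, RATM.step_of_tr h.state (by simp only [ht, Option.map_some]; rfl), ?_⟩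
  by_cases hj : M₂.jump a.next = true
  · simp only [hj, if_true]
    constructor
    · rfl
    · simp only [RATM.access, RATM.act, h.idx, h.input]; rfl
    · simp only [RATM.access, RATM.act]; rw [h.input₂]; rfl
    · simp only [RATM.access, RATM.act, h.idx_fst, Tape.write_read, h.fst]; rfl
    · intro t
      simp only [RATM.access, RATM.act, h.idx_snd, h.snd, Tape.map_write, Tape.map_goto]
    · simp only [RATM.access, RATM.act, h.idx]
    · simp only [RATM.access, RATM.act, h.idx_fst]
    · intro t; simp only [RATM.access, RATM.act, h.idx_snd]
  · simp only [hj, Bool.false_eq_true, if_false]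
    constructor
    · rfl
    · simp only [RATM.act, h.input]; rfl
    · simp only [RATM.act]; rw [h.input₂]; rfl
    · simp only [RATM.act, Tape.write_read, h.fst]; rfl
    · intro t
      simp only [RATM.act, h.snd, Tape.map_write]
    · simp only [RATM.act, h.idx]
    · simp only [RATM.act, h.idx_fst]
    · intro t; simp only [RATM.act, h.idx_snd]

theorem SimSnd.steps {x : List A} {z : List B₁} {x₂ : List A₂} {c d : M₂.Cfg} {n : ℕ}
    {C : (M₁.comp M₂ φ₁ φ₂ b).Cfg} (hx : ∀ i : ℕ, φ₂ x[i]? z[i]? = x₂[i]?)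
    (h : SimSnd x z x₂ c C) (hd : M₂.Steps n c d) :
    ∃ D, (M₁.comp M₂ φ₁ φ₂ b).Steps n C D ∧ SimSnd x z x₂ d D := by
  induction hd generalizing C with
  | refl c => exact ⟨C, RATM.Steps.refl C, h⟩
  | head hs _ ih =>
    obtain ⟨C', hC', h'⟩ := h.step hx hs
    obtain ⟨D, hD, h''⟩ := ih h'
    exact ⟨D, RATM.Steps.head hC' hD, h''⟩

/-- The constant is the 8 from `comp_ready` plus the step that enters the start state of `M₂`. -/
theorem RATM.comp_outputsIn {x : List A} {x₁ : List A₁} {z : List B₁} {x₂ : List A₂}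
    {y : List B₂} {t₁ t₂ : ℕ} (hb : b = true ∨ M₁.Ordinary)
    (hx₁ : ∀ i : ℕ, φ₁ x[i]? = x₁[i]?) (h₁ : M₁.OutputsIn x₁ z t₁)
    (hx₂ : ∀ i : ℕ, φ₂ x[i]? z[i]? = x₂[i]?) (h₂ : M₂.OutputsIn x₂ y t₂) :
    (M₁.comp M₂ φ₁ φ₂ b).OutputsIn x y (4 * t₁ + t₂ + 9) := by
  obtain ⟨s, hs, c, hc, hh, hz⟩ := h₁
  obtain ⟨s', hs', c', hc', hh', hy⟩ := h₂
  obtain ⟨C, SC, e1, e2, e3, e4, e5⟩ := comp_ready (M₂ := M₂) (φ₂ := φ₂) hx₁ hb hc hh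
  obtain ⟨D, hD, h⟩ := SimSnd.init x₂ hz e1 e2 e3 e4 e5
  obtain ⟨D', SD, h'⟩ := h.steps hx₂ (RATM.steps_of_run hc')
  refine RATM.outputsIn_of_steps ((SC.trans (RATM.Steps.single hD)).trans SD) (by omega) ?_ ?_
  · have ht : M₂.tr c'.state c'.input.read (fun t => (c'.work t).read)
        (fun t => (c'.idx t).read) = none := by simpa [RATM.step] using hh'
    rw [← h'.tr hx₂] at ht
    unfold RATM.step
    rw [h'.state]
    simp only [ht, Option.map_none]
  · intro i
    have := h'.snd M₂.out
    simp only [this, Tape.map, hy]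
    cases y[i]? <;> rfl

end Comp

/-- Two machines can be composed sequentially, the second one reading the input of the first one
along with its output. -/
theorem exists_comp {A A₁ A₂ B₁ B₂ : Type} [Finite B₁] (M₁ : RATM A₁ B₁) (M₂ : RATM A₂ B₂)
    (φ₁ : Option A → Option A₁) (φ₂ : Option A → Option B₁ → Option A₂) :
    ∃ M : RATM A B₂, (M₁.Ordinary → M₂.Ordinary → M.Ordinary) ∧
      ∀ x x₁ z x₂ y t₁ t₂, (∀ i : ℕ, φ₁ x[i]? = x₁[i]?) → M₁.OutputsIn x₁ z t₁ →
        (∀ i : ℕ, φ₂ x[i]? z[i]? = x₂[i]?) → M₂.OutputsIn x₂ y t₂ →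
        M.OutputsIn x y (4 * t₁ + t₂ + 9) := by
  -- The final jump of the clean-up is used only when `M₁` is not ordinary; otherwise the
  -- composition must not introduce a jump of its own.
  by_cases h : M₁.Ordinary
  · exact ⟨M₁.comp M₂ φ₁ φ₂ false, fun h₁ h₂ => RATM.comp_ordinary h₁ h₂ _ _,
      fun _ _ _ _ _ _ _ => RATM.comp_outputsIn (Or.inr h)⟩
  · exact ⟨M₁.comp M₂ φ₁ φ₂ true, fun h₁ => absurd h₁ h,
      fun _ _ _ _ _ _ _ => RATM.comp_outputsIn (Or.inl rfl)⟩

/-! ### Pairs -/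

section Pair

variable {A B C : Type}

/-- The symbol of a pair of tracks with the given symbols. -/
def pairSym : Option A → Option B → Option (Option A × Option B)
  | none, none => none
  | a, b => some (a, b)

theorem pair_getElem? (x : List A) (y : List B) (i : ℕ) :
    (pair x y)[i]? = pairSym x[i]? y[i]? := by
  unfold pair
  rw [List.getElem?_map]
  by_cases h : i < max x.length y.length
  · rw [List.getElem?_range h, Option.map_some]
    rcases lt_max_iff.1 h with h | h
    · rw [List.getElem?_eq_getElem h]; cases y[i]? <;> rfl
    · rw [List.getElem?_eq_getElem h]; cases x[i]? <;> rfl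
  · rw [List.getElem?_eq_none (by simpa using h), List.getElem?_eq_none (by grind),
      List.getElem?_eq_none (by grind)]
    rfl

theorem pairSym_fst (a : Option A) (b : Option B) : (pairSym a b).bind Prod.fst = a := by
  cases a <;> cases b <;> rfl

theorem pairSym_snd (a : Option A) (b : Option B) : (pairSym a b).bind Prod.snd = b := by
  cases a <;> cases b <;> rfl

theorem length_pair (x : List A) (y : List B) : (pair x y).length = max x.length y.length := by
  simp [pair]

end Pair

/-! ### Polynomial time -/

theorem eval_polynomial_mono (p : Polynomial ℕ) {m n : ℕ} (h : m ≤ n) : p.eval m ≤ p.eval n := by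
  rw [Polynomial.eval_eq_sum, Polynomial.eval_eq_sum]
  exact Finset.sum_le_sum fun i _ => Nat.mul_le_mul_left _ (Nat.pow_le_pow_left h i)

theorem PolyTime.exists_length_le {A B : Type} {f : List A → List B} (hf : PolyTime f) :
    ∃ p : Polynomial ℕ, ∀ x, (f x).length ≤ p.eval x.length := by
  obtain ⟨M, p, -, h⟩ := hf
  exact ⟨p, fun x => (h x).length_le⟩

/-- The machine that copies its input. -/
abbrev copyMachine (A : Type) : RATM A A where
  Q := Unit
  E := Empty
  T := Unit
  finQ := inferInstance
  finE := inferInstance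
  finT := inferInstance
  out := ()
  start := ()
  jump _ := false
  tr _ a _ i := a.map fun a =>
    { next := ()
      inp := Move.right
      work := fun _ => (some (Sum.inl a), Move.right)
      idx := fun t => (i t, Move.stay) }

theorem copyMachine_ordinary (A : Type) : (copyMachine A).Ordinary := fun _ => rfl

theorem copyMachine_outputsIn {A : Type} (x : List A) :
    (copyMachine A).OutputsIn x x x.length := by
  have key : ∀ n ≤ x.length, ∃ c, (copyMachine A).run x n = some c ∧
      c.input = (Tape.ofList x).goto n ∧
      ∀ t, c.work t = ((Tape.ofList (x.take n)).map Sum.inl).goto n := by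
    intro n hn
    induction n with
    | zero => exact ⟨_, rfl, rfl, fun t => by
        rw [List.take_zero, Tape.map_ofList_nil]; rfl⟩
    | succ n ih =>
      obtain ⟨c, hc, h1, h2⟩ := ih (by omega)
      have hr : c.input.read = some x[n] := by
        rw [h1]; exact List.getElem?_eq_getElem (show n < x.length by omega)
      have hs := RATM.step_of_tr_of_jump (M := copyMachine A) (c := c) rfl
        (by simp only [copyMachine, hr, Option.map_some]; rfl) rfl
      refine ⟨_, by rw [RATM.run, hc]; exact hs, ?_, ?_⟩
      · simp only [RATM.act, h1]; rfl
      · intro t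
        simp only [RATM.act, h2]
        refine Tape.ext' rfl fun i => ?_
        simp only [Tape.write, Tape.goto, Tape.map, Tape.ofList, Function.update_apply]
        grind
  obtain ⟨c, hc, h1, h2⟩ := key x.length le_rfl
  refine ⟨_, le_rfl, c, hc, ?_, fun i => ?_⟩
  · have hr : c.input.read = none := by rw [h1]; exact List.getElem?_eq_none le_rfl
    simp [RATM.step, copyMachine, hr]
  · rw [h2]; simp [Tape.goto, Tape.map, Tape.ofList]

theorem PolyTime.comp {A B C : Type} [Finite B] {f : List A → List B} {g : List B → List C}
    (hg : PolyTime g) (hf : PolyTime f) : PolyTime fun x => g (f x) := by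
  obtain ⟨M₁, p, o₁, h₁⟩ := hf
  obtain ⟨M₂, q, o₂, h₂⟩ := hg
  obtain ⟨M, hM, h⟩ := exists_comp M₁ M₂ id fun _ b => b
  refine ⟨M, 4 * p + q.comp p + 9, hM o₁ o₂, fun x => ?_⟩
  refine (h x x (f x) (f x) _ _ _ (fun _ => rfl) (h₁ x) (fun _ => rfl) (h₂ _)).mono ?_
  -- The intermediate string is no longer than the time taken to produce it.
  have := eval_polynomial_mono q (h₁ x).length_le
  simp only [Polynomial.eval_add, Polynomial.eval_mul, Polynomial.eval_comp,
    Polynomial.eval_ofNat]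
  omega

/-- Two nested compositions: after `f x` is computed, the inner one computes `g x` from the track
holding `x`, and the copying machine then reads `f x` and `g x` as two tracks and writes them out as
one string. -/
theorem PolyTime.pair {A B C : Type} [Finite B] [Finite C] {f : List A → List B}
    {g : List A → List C} (hf : PolyTime f) (hg : PolyTime g) :
    PolyTime fun x => pair (f x) (g x) := by
  obtain ⟨M₁, p, o₁, h₁⟩ := hf
  obtain ⟨M₂, q, o₂, h₂⟩ := hg
  obtain ⟨N, hN, h⟩ := exists_comp (A := Option A × Option B) M₂
    (copyMachine (Option B × Option C)) (fun s => s.bind Prod.fst)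
    fun s c => pairSym (s.bind Prod.snd) c
  obtain ⟨M, hM, h'⟩ := exists_comp M₁ N id pairSym
  refine ⟨M, 5 * p + 5 * q + 18, hM o₁ (hN o₂ (copyMachine_ordinary _)), fun x => ?_⟩
  have e := h (PsPL.pair x (f x)) x (g x) (PsPL.pair (f x) (g x)) (PsPL.pair (f x) (g x)) _ _
    (fun i => by rw [pair_getElem?, pairSym_fst]) (h₂ x)
    (fun i => by rw [pair_getElem?, pairSym_snd, pair_getElem?]) (copyMachine_outputsIn _)
  refine (h' x x (f x) (PsPL.pair x (f x)) _ _ _ (fun _ => rfl) (h₁ x)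
    (fun i => (pair_getElem? _ _ i).symm) e).mono ?_
  have := (h₁ x).length_le
  have := (h₂ x).length_le
  simp only [Polynomial.eval_add, Polynomial.eval_mul, Polynomial.eval_ofNat, length_pair]
  omega

/-! ### Evaluating circuits in polynomial time -/

/-- What to do with a fetched bit. -/
inductive EvalOp where
  | inp
  | neg
  | conj
  | disj
  | out

/-- The control states of the circuit evaluator. -/
inductive EvalState where
  | start
  | copy
  | back
  | main
  | rew (o : EvalOp) (u : Option Bool)
  | walk (o : EvalOp) (u : Option Bool)
  | app (r : Bool)
  | seek (r : Bool)

instance : Finite EvalOp := by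
  refine Finite.of_injective (β := Fin 5) (fun p => match p with
    | .inp => 0 | .neg => 1 | .conj => 2 | .disj => 3 | .out => 4) ?_
  intro a b; cases a <;> cases b <;> simp

instance : Finite EvalState := by
  refine Finite.of_injective (β := Fin 4 ⊕ (Bool × EvalOp × Option Bool) ⊕ (Bool × Bool))
    (fun p => match p with
    | .start => .inl 0 | .copy => .inl 1 | .back => .inl 2 | .main => .inl 3
    | .rew o u => .inr (.inl (true, o, u)) | .walk o u => .inr (.inl (false, o, u))
    | .app r => .inr (.inr (true, r)) | .seek r => .inr (.inr (false, r))) ?_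
  intro a b; cases a <;> cases b <;> simp

/-- The symbols on the work tape of the circuit evaluator, which has two tracks for the input and
the values of the gates. The symbol `none` marks the left end. -/
abbrev EvalSym : Type := Bool ⊕ Option (Option Bool × Option Bool)

/-- The mark at the left end. -/
def markSym : EvalSym := Sum.inr none

/-- A symbol with two tracks. -/
def trackSym (a : Option Bool × Option Bool) : EvalSym := Sum.inr (some a)

/-- The two tracks of a symbol. -/
def tracks : Option EvalSym → Option Bool × Option Bool
  | some (Sum.inr (some a)) => a
  | _ => (none, none)

/-- Is this the mark at the left end? -/
def isMark : Option EvalSym → Bool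
  | some (Sum.inr none) => true
  | _ => false

/-- The actions of the circuit evaluator: next state, movement on the input tape, and actions on the
work tape and on the output tape. -/
def evalAct (q : EvalState) (m : Move) (v o : Option EvalSym × Move) :
    Action EvalState EvalSym Bool where
  next := q
  inp := m
  work := fun t => cond t o v
  idx := fun _ => (none, Move.stay)

/-- The bit that is fetched from a symbol. -/
def EvalOp.fetch (o : EvalOp) (s : Option EvalSym) : Bool :=
  match o with
  | .inp => (tracks s).1.getD false
  | _ => (tracks s).2.getD false

/-- The action after the bit `v` has been fetched. -/
def EvalOp.finish (o : EvalOp) (u : Option Bool) (v : Bool) (s t : Option EvalSym) :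
    Action EvalState EvalSym Bool :=
  match o, u with
  | .inp, _ => evalAct (.app v) .stay (s, .stay) (t, .stay)
  | .neg, _ => evalAct (.app !v) .stay (s, .stay) (t, .stay)
  | .conj, some u => evalAct (.app (u && v)) .stay (s, .stay) (t, .stay)
  | .disj, some u => evalAct (.app (u || v)) .stay (s, .stay) (t, .stay)
  | .out, some true => evalAct .main .stay (s, .stay) (some (Sum.inl v), .right)
  | .out, some false => evalAct .main .stay (s, .stay) (t, .stay)
  | o, none => evalAct (.rew o (some v)) .right (s, .stay) (t, .stay)

/-- The transitions of the circuit evaluator, with input symbol `a`, work symbol `s` and output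
symbol `t`. -/
def evalTr (q : EvalState) (a : Option (Option Bool × Option CSym)) (s t : Option EvalSym) :
    Option (Action EvalState EvalSym Bool) :=
  match q with
  | .start => some <| evalAct .copy .stay (some markSym, .right) (t, .stay)
  | .copy =>
    match a.bind Prod.fst with
    | some b => some <| evalAct .copy .right (some (trackSym (some b, none)), .right) (t, .stay)
    | none => some <| evalAct .back .stay (s, .stay) (t, .stay)
  | .back => some <|
    if isMark s then evalAct .main .stay (s, .stay) (t, .stay)
    else evalAct .back .left (s, .left) (t, .stay)
  | .main =>
    match a.bind Prod.snd with
    | some .tt => some <| evalAct (.app true) .right (s, .stay) (t, .stay)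
    | some .ff => some <| evalAct (.app false) .right (s, .stay) (t, .stay)
    | some .inp => some <| evalAct (.rew .inp none) .right (s, .stay) (t, .stay)
    | some .neg => some <| evalAct (.rew .neg none) .right (s, .stay) (t, .stay)
    | some .conj => some <| evalAct (.rew .conj none) .right (s, .stay) (t, .stay)
    | some .disj => some <| evalAct (.rew .disj none) .right (s, .stay) (t, .stay)
    | some .out => some <| evalAct (.rew .out none) .right (s, .stay) (t, .stay)
    | _ => none
  | .rew o u => some <|
    if isMark s then evalAct (.walk o u) .stay (s, .right) (t, .stay)
    else evalAct (.rew o u) .stay (s, .left) (t, .stay)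
  | .walk o u => some <|
    match a.bind Prod.snd with
    | some .tick => evalAct (.walk o u) .right (s, .right) (t, .stay)
    | _ => o.finish u (o.fetch s) s t
  | .app r => some <|
    if isMark s then evalAct (.seek r) .stay (s, .right) (t, .stay)
    else evalAct (.app r) .stay (s, .left) (t, .stay)
  | .seek r => some <|
    match (tracks s).2 with
    | some _ => evalAct (.seek r) .stay (s, .right) (t, .stay)
    | none => evalAct .main .stay (some (trackSym ((tracks s).1, some r)), .right) (t, .stay)

/-- The circuit evaluator: from an input string and the description of a circuit, it computes the
output string of the circuit. -/
abbrev evaluator : RATM (Option Bool × Option CSym) Bool where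
  Q := EvalState
  E := Option (Option Bool × Option Bool)
  T := Bool
  finQ := inferInstance
  finE := inferInstance
  finT := inferInstance
  out := true
  start := .start
  jump _ := false
  tr q a w _ := evalTr q a (w false) (w true)

theorem evaluator_ordinary : evaluator.Ordinary := fun _ => rfl

/-- The configurations of the circuit evaluator. -/
def evalCfg (q : EvalState) (I : Tape (Option Bool × Option CSym)) (W O : Tape EvalSym) :
    evaluator.Cfg where
  state := q
  input := I
  work := fun t => cond t O W
  idx := fun _ => Tape.ofList []

theorem evaluator_init (x : List (Option Bool × Option CSym)) :
    evaluator.init x = evalCfg .start (Tape.ofList x) (Tape.ofList []) (Tape.ofList []) := by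
  simp only [RATM.init, evalCfg, RATM.Cfg.mk.injEq, true_and, and_true]
  funext t; cases t <;> rfl

theorem evaluator_step {q q' : EvalState} {I : Tape (Option Bool × Option CSym)}
    {W O : Tape EvalSym} {m : Move} {v o : Option EvalSym × Move}
    (h : evalTr q I.read W.read O.read = some (evalAct q' m v o)) :
    evaluator.step (evalCfg q I W O) =
      some (evalCfg q' (I.move m) (W.write v.1 v.2) (O.write o.1 o.2)) := by
  refine (RATM.step_of_tr_of_jump (M := evaluator) (q := q) rfl h rfl).trans
    (congrArg some ?_)
  simp only [RATM.act, evalCfg, evalAct, RATM.Cfg.mk.injEq, true_and]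
  refine ⟨funext fun t => by cases t <;> rfl, funext fun _ => ?_⟩
  simp [Tape.write, Tape.ofList, Move.apply]

/-- The work tape of the circuit evaluator. -/
def evalTape (x vs : List Bool) (p : ℕ) : Tape EvalSym where
  cells
    | 0 => some markSym
    | i + 1 => (pairSym x[i]? vs[i]?).map trackSym
  head := p

/-! ### Elementary moves of the circuit evaluator -/

theorem isMark_evalTape (x vs : List Bool) (p : ℕ) :
    isMark (evalTape x vs p).read = decide (p = 0) := by
  cases p with
  | zero => rfl
  | succ p =>
    simp only [Tape.read, evalTape]
    cases pairSym x[p]? vs[p]? <;> rfl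

theorem tracks_evalTape (x vs : List Bool) (p : ℕ) :
    tracks (evalTape x vs (p + 1)).read = (x[p]?, vs[p]?) := by
  simp only [Tape.read, evalTape]
  cases x[p]? <;> cases vs[p]? <;> rfl

theorem evalTape_write_value (x vs : List Bool) (r : Bool) :
    (evalTape x vs (vs.length + 1)).write (some (trackSym (x[vs.length]?, some r))) .right =
      evalTape x (vs ++ [r]) (vs.length + 2) := by
  refine Tape.ext' rfl fun i => ?_
  simp only [Tape.write, Function.update_apply]
  cases i with
  | zero => simp [evalTape]
  | succ i =>
    simp only [evalTape, Nat.add_right_cancel_iff]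
    by_cases h : i = vs.length
    · subst h
      simp only [if_true, List.getElem?_concat_length]
      cases x[vs.length]? <;> rfl
    · rw [if_neg h]
      congr 2
      grind

theorem evalTape_write_input (x : List Bool) (b : Bool) :
    (evalTape x [] (x.length + 1)).write (some (trackSym (some b, none))) .right =
      evalTape (x ++ [b]) [] (x.length + 2) := by
  refine Tape.ext' rfl fun i => ?_
  simp only [Tape.write, Function.update_apply]
  cases i with
  | zero => simp [evalTape]
  | succ i =>
    simp only [evalTape, Nat.add_right_cancel_iff]
    by_cases h : i = x.length
    · subst h
      simp only [if_true, List.getElem?_concat_length]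
      rfl
    · rw [if_neg h]
      congr 2
      grind

/-- Abstracted over the states because the return to the mark is shared by `rew`, before a bit is
fetched, and `app`, before a value is appended. -/
theorem evaluator_rew {q q' : EvalState} {I : Tape (Option Bool × Option CSym)}
    (hq : ∀ s t, evalTr q I.read s t = some (if isMark s then evalAct q' .stay (s, .right) (t, .stay)
      else evalAct q .stay (s, .left) (t, .stay))) (x vs : List Bool) (O : Tape EvalSym) (p : ℕ) :
    evaluator.Steps (p + 1) (evalCfg q I (evalTape x vs p) O)
      (evalCfg q' I (evalTape x vs 1) O) := by
  induction p with
  | zero =>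
    refine RATM.Steps.single ((evaluator_step (by
      rw [hq, isMark_evalTape]; simp only [decide_true, if_true]; rfl)).trans ?_)
    simp only [Tape.write_read]; rfl
  | succ p ih =>
    refine RATM.Steps.head ((evaluator_step (by
      rw [hq, isMark_evalTape, if_neg (by simp)])).trans ?_) ih
    simp only [Tape.write_read]; rfl

/-- The input tape of the circuit evaluator, with the head on cell `p`. -/
def evalInput (x : List Bool) (code : List CSym) (p : ℕ) : Tape (Option Bool × Option CSym) :=
  (Tape.ofList (pair x code)).goto p

theorem evalInput_fst (x : List Bool) (code : List CSym) (p : ℕ) :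
    (evalInput x code p).read.bind Prod.fst = x[p]? := by
  simp only [evalInput, Tape.goto, Tape.read, Tape.ofList, pair_getElem?, pairSym_fst]

theorem evalInput_snd (x : List Bool) (code : List CSym) (p : ℕ) :
    (evalInput x code p).read.bind Prod.snd = (code.drop p).head? := by
  simp only [evalInput, Tape.goto, Tape.read, Tape.ofList, pair_getElem?, pairSym_snd,
    List.head?_drop]

theorem drop_succ_of_drop {α : Type} {l w : List α} {a : α} {p : ℕ} (h : l.drop p = a :: w) :
    l.drop (p + 1) = w := by
  rw [← List.tail_drop, h, List.tail_cons]

theorem drop_add_of_drop {α : Type} {l v w : List α} {p : ℕ} (h : l.drop p = v ++ w) :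
    l.drop (p + v.length) = w := by
  rw [← List.drop_drop, h, List.drop_left]

/-! ### Evaluation of gates and output positions -/

section Evaluator

variable {x vs : List Bool} {code post : List CSym} {O : Tape EvalSym}

theorem evaluator_walk {o : EvalOp} {u : Option Bool} {n p : ℕ}
    (h : code.drop p = unary n ++ post) (k : ℕ) :
    evaluator.Steps n (evalCfg (.walk o u) (evalInput x code p) (evalTape x vs k) O)
      (evalCfg (.walk o u) (evalInput x code (p + n)) (evalTape x vs (k + n)) O) := by
  induction n generalizing p k with
  | zero => exact RATM.Steps.refl _
  | succ n ih =>
    have h' : code.drop p = CSym.tick :: (unary n ++ post) := h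
    have := ih (drop_succ_of_drop h') (k + 1)
    rw [show p + 1 + n = p + (n + 1) by omega, show k + 1 + n = k + (n + 1) by omega] at this
    refine RATM.Steps.head ((evaluator_step (by
      simp only [evalTr, evalInput_snd, h', List.head?_cons]; rfl)).trans ?_) this
    simp only [Tape.write_read]; rfl

/-- Gate numbers are written in unary, so the heads on the description and on the work tape advance
in lockstep. Entry `n` of either track lies in cell `n + 1` because of the mark. -/
theorem evaluator_fetch {o : EvalOp} {u : Option Bool} {n p : ℕ}
    (h : code.drop p = unary n ++ post) (k : ℕ) :
    evaluator.Steps (k + 1 + n)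
      (evalCfg (.rew o u) (evalInput x code p) (evalTape x vs k) O)
      (evalCfg (.walk o u) (evalInput x code (p + n)) (evalTape x vs (n + 1)) O) := by
  have := evaluator_walk (x := x) (vs := vs) (O := O) (o := o) (u := u) h 1
  rw [Nat.add_comm 1 n] at this
  exact (evaluator_rew (fun s t => rfl) x vs O k).trans this

theorem evalTr_walk {o : EvalOp} {u : Option Bool} {p : ℕ}
    (h : (code.drop p).head? ≠ some CSym.tick) (s t : Option EvalSym) :
    evalTr (.walk o u) (evalInput x code p).read s t = some (o.finish u (o.fetch s) s t) := by
  simp only [evalTr, evalInput_snd]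

theorem fetch_evalTape (o : EvalOp) (n : ℕ) : o.fetch (evalTape x vs (n + 1)).read =
    match o with
    | .inp => x.getD n false
    | _ => vs.getD n false := by
  cases o <;> simp [EvalOp.fetch, tracks_evalTape, List.getD_eq_getElem?_getD]

theorem evaluator_seek {r : Bool} {I : Tape (Option Bool × Option CSym)} {d k : ℕ}
    (h : k + d = vs.length) :
    evaluator.Steps (d + 1) (evalCfg (.seek r) I (evalTape x vs (k + 1)) O)
      (evalCfg .main I (evalTape x (vs ++ [r]) (vs.length + 2)) O) := by
  induction d generalizing k with
  | zero =>
    obtain rfl : k = vs.length := by omega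
    refine RATM.Steps.single ((evaluator_step (by
      simp only [evalTr, tracks_evalTape, List.getElem?_eq_none le_rfl]; rfl)).trans ?_)
    rw [evalTape_write_value]
    simp only [Tape.write_read]; rfl
  | succ d ih =>
    refine RATM.Steps.head ((evaluator_step (by
      simp only [evalTr, tracks_evalTape,
        List.getElem?_eq_getElem (show k < vs.length by omega)]; rfl)).trans ?_)
      (ih (k := k + 1) (by omega))
    simp only [Tape.write_read]; rfl

/-- The place for a new gate value is found without counting: it is the first cell after the mark
whose value track is blank. -/
theorem evaluator_app {r : Bool} {I : Tape (Option Bool × Option CSym)} (k : ℕ) :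
    evaluator.Steps (k + vs.length + 2) (evalCfg (.app r) I (evalTape x vs k) O)
      (evalCfg .main I (evalTape x (vs ++ [r]) (vs.length + 2)) O) := by
  have := (evaluator_rew (q := .app r) (q' := .seek r) (I := I) (fun s t => rfl) x vs O k).trans
    (evaluator_seek (x := x) (vs := vs) (O := O) (r := r) (I := I) (d := vs.length) (k := 0)
      (by omega))
  rwa [show k + 1 + (vs.length + 1) = k + vs.length + 2 by omega] at this

theorem evaluator_main {q : EvalState} {c : CSym} {p : ℕ} (h : code.drop p = c :: post)
    (hc : ∀ a s t, a.bind Prod.snd = some c →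
      evalTr .main a s t = some (evalAct q .right (s, .stay) (t, .stay))) (W : Tape EvalSym) :
    evaluator.step (evalCfg .main (evalInput x code p) W O) =
      some (evalCfg q (evalInput x code (p + 1)) W O) := by
  refine (evaluator_step (hc _ _ _ (by rw [evalInput_snd, h, List.head?_cons]))).trans ?_
  simp only [Tape.write_read]; rfl

theorem evaluator_unary_gate {o : EvalOp} {r : Bool} {n p : ℕ} (h : code.drop p = unary n ++ post)
    (hp : post.head? ≠ some CSym.tick)
    (ho : ∀ s t, o.finish none (o.fetch (evalTape x vs (n + 1)).read) s t =
      evalAct (.app r) .stay (s, .stay) (t, .stay)) (k : ℕ) :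
    evaluator.Steps (k + 2 * n + vs.length + 5)
      (evalCfg (.rew o none) (evalInput x code p) (evalTape x vs k) O)
      (evalCfg .main (evalInput x code (p + n)) (evalTape x (vs ++ [r]) (vs.length + 2)) O) := by
  have hd : code.drop (p + n) = post := by
    have := drop_add_of_drop h; rwa [unary, List.length_replicate] at this
  have h1 := evaluator_fetch (x := x) (vs := vs) (O := O) (o := o) (u := none) h k
  have h2 : evaluator.step (evalCfg (.walk o none) (evalInput x code (p + n))
      (evalTape x vs (n + 1)) O) = some (evalCfg (.app r) (evalInput x code (p + n))
      (evalTape x vs (n + 1)) O) := by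
    refine (evaluator_step ((evalTr_walk (by rwa [hd]) _ _).trans (congrArg some (ho _ _)))).trans ?_
    simp only [Tape.write_read]; rfl
  have := (h1.trans (RATM.Steps.single h2)).trans (evaluator_app (n + 1))
  rwa [show k + 1 + n + 1 + (n + 1 + vs.length + 2) = k + 2 * n + vs.length + 5 by omega] at this

theorem evaluator_first {o : EvalOp} {c : CSym} {i p : ℕ}
    (h : code.drop p = unary i ++ c :: post) (hc : c ≠ CSym.tick)
    (ho : ∀ v s t, o.finish none v s t = evalAct (.rew o (some v)) .right (s, .stay) (t, .stay))
    (k : ℕ) :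
    evaluator.Steps (k + i + 2)
      (evalCfg (.rew o none) (evalInput x code p) (evalTape x vs k) O)
      (evalCfg (.rew o (some (o.fetch (evalTape x vs (i + 1)).read)))
        (evalInput x code (p + i + 1)) (evalTape x vs (i + 1)) O) := by
  have hd : code.drop (p + i) = c :: post := by
    have := drop_add_of_drop h; rwa [unary, List.length_replicate] at this
  have h1 := evaluator_fetch (x := x) (vs := vs) (O := O) (o := o) (u := none) h k
  have h2 : evaluator.step (evalCfg (.walk o none) (evalInput x code (p + i))
      (evalTape x vs (i + 1)) O) = some (evalCfg (.rew o (some (o.fetch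
        (evalTape x vs (i + 1)).read))) (evalInput x code (p + i + 1))
      (evalTape x vs (i + 1)) O) := by
    refine (evaluator_step ((evalTr_walk (by rw [hd]; simpa using hc) _ _).trans
      (congrArg some (ho _ _ _)))).trans ?_
    simp only [Tape.write_read]; rfl
  have := h1.trans (RATM.Steps.single h2)
  rwa [show k + 1 + i + 1 = k + i + 2 by omega] at this

theorem evaluator_second {o : EvalOp} {u : Bool} {q : EvalState} {t : Option EvalSym × Move}
    {j p : ℕ} (h : code.drop p = unary j ++ post) (hp : post.head? ≠ some CSym.tick)
    (ho : ∀ s, o.finish (some u) (o.fetch (evalTape x vs (j + 1)).read) s O.read =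
      evalAct q .stay (s, .stay) t) (k : ℕ) :
    evaluator.Steps (k + j + 2)
      (evalCfg (.rew o (some u)) (evalInput x code p) (evalTape x vs k) O)
      (evalCfg q (evalInput x code (p + j)) (evalTape x vs (j + 1)) (O.write t.1 t.2)) := by
  have hd : code.drop (p + j) = post := by
    have := drop_add_of_drop h; rwa [unary, List.length_replicate] at this
  have h1 := evaluator_fetch (x := x) (vs := vs) (O := O) (o := o) (u := some u) h k
  have h2 : evaluator.step (evalCfg (.walk o (some u)) (evalInput x code (p + j))
      (evalTape x vs (j + 1)) O) = some (evalCfg q (evalInput x code (p + j))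
      (evalTape x vs (j + 1)) (O.write t.1 t.2)) := by
    refine (evaluator_step ((evalTr_walk (by rwa [hd]) _ _).trans
      (congrArg some (ho _)))).trans ?_
    simp only [Tape.write_read]; rfl
  have := h1.trans (RATM.Steps.single h2)
  rwa [show k + 1 + j + 1 = k + j + 2 by omega] at this

theorem evaluator_binary_gate {o : EvalOp} {f : Bool → Bool → Bool} {i j p : ℕ}
    (h : code.drop p = unary i ++ CSym.sep :: unary j ++ post)
    (hp : post.head? ≠ some CSym.tick)
    (h₁ : ∀ v s t, o.finish none v s t = evalAct (.rew o (some v)) .right (s, .stay) (t, .stay))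
    (h₂ : ∀ u v s t, o.finish (some u) v s t = evalAct (.app (f u v)) .stay (s, .stay) (t, .stay))
    (k : ℕ) :
    evaluator.Steps (k + 2 * i + 2 * j + vs.length + 8)
      (evalCfg (.rew o none) (evalInput x code p) (evalTape x vs k) O)
      (evalCfg .main (evalInput x code (p + i + 1 + j)) (evalTape x
        (vs ++ [f (o.fetch (evalTape x vs (i + 1)).read) (o.fetch (evalTape x vs (j + 1)).read)])
        (vs.length + 2)) O) := by
  have h' : code.drop p = unary i ++ CSym.sep :: (unary j ++ post) := by simpa using h
  have hd : code.drop (p + i + 1) = unary j ++ post := by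
    have := drop_add_of_drop h'
    rw [unary, List.length_replicate] at this
    exact drop_succ_of_drop this
  have s1 := evaluator_first (x := x) (vs := vs) (O := O) h' (by simp) h₁ k
  have s2 := evaluator_second (x := x) (vs := vs) (O := O)
    (u := o.fetch (evalTape x vs (i + 1)).read) hd hp (fun s => h₂ _ _ _ _) (i + 1)
  rw [show (O.write O.read Move.stay) = O by rw [Tape.write_read]; rfl] at s2
  have := (s1.trans s2).trans (evaluator_app (j + 1))
  rwa [show k + i + 2 + (i + 1 + j + 2) + (j + 1 + vs.length + 2) =
    k + 2 * i + 2 * j + vs.length + 8 by omega] at this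

theorem evaluator_gate {g : Gate} {p : ℕ} (h : code.drop p = g.code ++ post)
    (hp : post.head? ≠ some CSym.tick) (k : ℕ) :
    ∃ t ≤ k + 2 * g.code.length + vs.length + 9, evaluator.Steps t
      (evalCfg .main (evalInput x code p) (evalTape x vs k) O)
      (evalCfg .main (evalInput x code (p + g.code.length))
        (evalTape x (vs ++ [g.eval x vs]) (vs.length + 2)) O) := by
  cases g with
  | lit b =>
    cases b
    · exact ⟨_, by simp only [Gate.code, List.length_cons]; omega,
        RATM.Steps.head (evaluator_main h (q := .app false) (fun a s t ha => by
          simp only [evalTr, ha]) _) (evaluator_app k)⟩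
    · exact ⟨_, by simp only [Gate.code, List.length_cons]; omega,
        RATM.Steps.head (evaluator_main h (q := .app true) (fun a s t ha => by
          simp only [evalTr, ha]) _) (evaluator_app k)⟩
  | inp j =>
    have hl : (Gate.inp j).code.length = 1 + j := by simp [Gate.code, unary]; omega
    rw [hl, ← Nat.add_assoc]
    have h' : code.drop p = CSym.inp :: (unary j ++ post) := h
    exact ⟨_, by omega, RATM.Steps.head (evaluator_main h' (q := .rew .inp none) (fun a s t ha => by
      simp only [evalTr, ha]) _) (evaluator_unary_gate (drop_succ_of_drop h') hp
        (fun s t => by rw [fetch_evalTape]; rfl) k)⟩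
  | neg j =>
    have hl : (Gate.neg j).code.length = 1 + j := by simp [Gate.code, unary]; omega
    rw [hl, ← Nat.add_assoc]
    have h' : code.drop p = CSym.neg :: (unary j ++ post) := h
    exact ⟨_, by omega, RATM.Steps.head (evaluator_main h' (q := .rew .neg none) (fun a s t ha => by
      simp only [evalTr, ha]) _) (evaluator_unary_gate (drop_succ_of_drop h') hp
        (fun s t => by rw [fetch_evalTape]; rfl) k)⟩
  | conj i j =>
    have hl : (Gate.conj i j).code.length = 1 + i + 1 + j := by simp [Gate.code, unary]; omega
    rw [hl, ← Nat.add_assoc, ← Nat.add_assoc, ← Nat.add_assoc]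
    have h' : code.drop p = CSym.conj :: (unary i ++ CSym.sep :: unary j ++ post) := h
    have := evaluator_binary_gate (x := x) (vs := vs) (O := O) (o := .conj) (f := and)
      (drop_succ_of_drop h') hp (fun _ _ _ => rfl) (fun _ _ _ _ => rfl) k
    simp only [fetch_evalTape] at this
    exact ⟨_, by omega, RATM.Steps.head (evaluator_main h' (q := .rew .conj none)
      (fun a s t ha => by simp only [evalTr, ha]) _) this⟩
  | disj i j =>
    have hl : (Gate.disj i j).code.length = 1 + i + 1 + j := by simp [Gate.code, unary]; omega
    rw [hl, ← Nat.add_assoc, ← Nat.add_assoc, ← Nat.add_assoc]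
    have h' : code.drop p = CSym.disj :: (unary i ++ CSym.sep :: unary j ++ post) := h
    have := evaluator_binary_gate (x := x) (vs := vs) (O := O) (o := .disj) (f := or)
      (drop_succ_of_drop h') hp (fun _ _ _ => rfl) (fun _ _ _ _ => rfl) k
    simp only [fetch_evalTape] at this
    exact ⟨_, by omega, RATM.Steps.head (evaluator_main h' (q := .rew .disj none)
      (fun a s t ha => by simp only [evalTr, ha]) _) this⟩

/-- Ensures that the last unary number of a description ends where it should, since the walk stops
only at a symbol other than a tick. -/
theorem head?_gates_append (gs : List Gate) (hp : post.head? ≠ some CSym.tick) :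
    (gs.flatMap Gate.code ++ post).head? ≠ some CSym.tick := by
  cases gs with
  | nil => exact hp
  | cons g gs =>
    rcases g with _ | ⟨_ | _⟩ | _ | _ | _ <;> simp [Gate.code]

/-- `H` bounds the work head, the room needed for the values, and the length of the description. By
`evaluator_gate` each gate then costs at most `H + 2 * H + H + 9` steps. -/
theorem evaluator_gates (gs : List Gate) {p k H : ℕ}
    (h : code.drop p = gs.flatMap Gate.code ++ post) (hp : post.head? ≠ some CSym.tick)
    (hk : k ≤ H) (hH : vs.length + gs.length + 2 ≤ H) (hc : code.length ≤ H) :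
    ∃ t ≤ gs.length * (4 * H + 9), ∃ k' ≤ H, evaluator.Steps t
      (evalCfg .main (evalInput x code p) (evalTape x vs k) O)
      (evalCfg .main (evalInput x code (p + (gs.flatMap Gate.code).length))
        (evalTape x (gs.foldl (fun vs g => vs ++ [g.eval x vs]) vs) k') O) := by
  induction gs generalizing p k vs with
  | nil => exact ⟨0, by simp, k, hk, RATM.Steps.refl _⟩
  | cons g gs ih =>
    have h' : code.drop p = g.code ++ (gs.flatMap Gate.code ++ post) := by
      simpa using h
    have hl : g.code.length ≤ code.length := by
      have := congrArg List.length h'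
      simp only [List.length_drop, List.length_append] at this
      omega
    obtain ⟨t₁, ht₁, s₁⟩ := evaluator_gate (x := x) (vs := vs) (O := O) h'
      (head?_gates_append gs hp) k
    simp only [List.length_cons] at hH
    obtain ⟨t₂, ht₂, k', hk', s₂⟩ := ih (vs := vs ++ [g.eval x vs]) (drop_add_of_drop h')
      (k := vs.length + 2) (by omega) (by simp; omega)
    refine ⟨t₁ + t₂, ?_, k', hk', ?_⟩
    · simp only [List.length_cons]; nlinarith
    · have := s₁.trans s₂
      rwa [Nat.add_assoc, ← List.length_append, ← List.flatMap_cons] at this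

/-- The output tape of the circuit evaluator. -/
def evalOutput (y : List Bool) : Tape EvalSym := ((Tape.ofList y).map Sum.inl).goto y.length

theorem evalOutput_write (y : List Bool) (v : Bool) :
    (evalOutput y).write (some (Sum.inl v)) .right = evalOutput (y ++ [v]) := by
  refine Tape.ext' (by simp [evalOutput, Tape.goto, Tape.write, Move.apply]) fun i => ?_
  simp only [evalOutput, Tape.write, Tape.goto, Tape.map, Tape.ofList, Function.update_apply]
  grind

/-- The symbol that an output position contributes. -/
def outSym (vs : List Bool) (o : ℕ × ℕ) : Option Bool :=
  if vs.getD o.1 false = true then some (vs.getD o.2 false) else none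

/-- The description of an output position. -/
def outCode (o : ℕ × ℕ) : List CSym := CSym.out :: (unary o.1 ++ CSym.sep :: unary o.2)

/-- The second number is read even if the first gate is false and nothing is written, so the input
head always ends behind the whole description of the position. -/
theorem evaluator_out {o : ℕ × ℕ} {y : List Bool} {p : ℕ} (h : code.drop p = outCode o ++ post)
    (hp : post.head? ≠ some CSym.tick) (k : ℕ) :
    evaluator.Steps (k + 2 * o.1 + o.2 + 6)
      (evalCfg .main (evalInput x code p) (evalTape x vs k) (evalOutput y))
      (evalCfg .main (evalInput x code (p + (outCode o).length)) (evalTape x vs (o.2 + 1))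
        (evalOutput (y ++ (outSym vs o).toList))) := by
  have hl : (outCode o).length = 1 + o.1 + 1 + o.2 := by simp [outCode, unary]; omega
  rw [hl, ← Nat.add_assoc, ← Nat.add_assoc, ← Nat.add_assoc]
  have h0 : code.drop p = CSym.out :: (unary o.1 ++ CSym.sep :: (unary o.2 ++ post)) := by
    simpa [outCode] using h
  have h' := drop_succ_of_drop h0
  have hd : code.drop (p + 1 + o.1 + 1) = unary o.2 ++ post := by
    have := drop_add_of_drop h'
    rw [unary, List.length_replicate] at this
    exact drop_succ_of_drop this
  have s0 := evaluator_main (x := x) (O := evalOutput y) h0 (q := .rew .out none)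
    (fun a s t ha => by simp only [evalTr, ha]) (evalTape x vs k)
  have s1 := evaluator_first (x := x) (vs := vs) (O := evalOutput y) (o := .out) h' (by simp)
    (fun _ _ _ => rfl) k
  have s2 : evaluator.Steps (o.1 + 1 + o.2 + 2)
      (evalCfg (.rew .out (some (EvalOp.out.fetch (evalTape x vs (o.1 + 1)).read)))
        (evalInput x code (p + 1 + o.1 + 1)) (evalTape x vs (o.1 + 1)) (evalOutput y))
      (evalCfg .main (evalInput x code (p + 1 + o.1 + 1 + o.2)) (evalTape x vs (o.2 + 1))
        (evalOutput (y ++ (outSym vs o).toList))) := by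
    simp only [fetch_evalTape, outSym]
    cases hv : vs.getD o.1 false
    · have := evaluator_second (x := x) (vs := vs) (O := evalOutput y) (o := .out) (u := false)
        hd hp (fun s => rfl) (o.1 + 1)
      rw [Tape.write_read, Tape.move_stay] at this
      simpa using this
    · have := evaluator_second (x := x) (vs := vs) (O := evalOutput y) (o := .out) (u := true)
        hd hp (fun s => rfl) (o.1 + 1)
      rw [evalOutput_write, fetch_evalTape] at this
      simpa using this
  have := RATM.Steps.head s0 (s1.trans s2)
  rwa [show k + o.1 + 2 + (o.1 + 1 + o.2 + 2) + 1 = k + 2 * o.1 + o.2 + 6 by omega] at this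

theorem evaluator_outs (os : List (ℕ × ℕ)) {y : List Bool} {p k H : ℕ}
    (h : code.drop p = os.flatMap outCode) (hk : k ≤ H) (hc : code.length ≤ H) :
    ∃ t ≤ os.length * (4 * H + 6), ∃ k', evaluator.Steps t
      (evalCfg .main (evalInput x code p) (evalTape x vs k) (evalOutput y))
      (evalCfg .main (evalInput x code (p + (os.flatMap outCode).length))
        (evalTape x vs k') (evalOutput (y ++ os.filterMap (outSym vs)))) := by
  induction os generalizing p k y with
  | nil => exact ⟨0, by simp, k, by simpa using RATM.Steps.refl _⟩
  | cons o os ih =>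
    have h' : code.drop p = outCode o ++ os.flatMap outCode := by simpa using h
    have hl : (outCode o).length ≤ code.length := by
      have := congrArg List.length h'
      simp only [List.length_drop, List.length_append] at this
      omega
    have hl' : (outCode o).length = 1 + o.1 + 1 + o.2 := by simp [outCode, unary]; omega
    have hp : (os.flatMap outCode).head? ≠ some CSym.tick := by
      cases os <;> simp [outCode]
    have s₁ := evaluator_out (x := x) (vs := vs) (y := y) h' hp k
    obtain ⟨t₂, ht₂, k', s₂⟩ := ih (y := y ++ (outSym vs o).toList) (drop_add_of_drop h')
      (k := o.2 + 1) (by omega)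
    refine ⟨k + 2 * o.1 + o.2 + 6 + t₂, ?_, k', ?_⟩
    rotate_left
    · have := s₁.trans s₂
      rw [Nat.add_assoc p, ← List.length_append, ← List.flatMap_cons, List.append_assoc] at this
      convert this using 4
      rw [List.filterMap_cons]
      cases outSym vs o <;> rfl
    · simp only [List.length_cons]; nlinarith

/-! ### Preparation and total running time of the evaluator -/

theorem evaluator_copy {k : ℕ} (hk : k ≤ x.length) :
    evaluator.Steps k (evalCfg .copy (evalInput x code 0) (evalTape [] [] 1) O)
      (evalCfg .copy (evalInput x code k) (evalTape (x.take k) [] (k + 1)) O) := by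
  induction k with
  | zero => exact RATM.Steps.refl _
  | succ k ih =>
    refine (ih (by omega)).trans (RATM.Steps.single ((evaluator_step (by
      simp only [evalTr, evalInput_fst,
        List.getElem?_eq_getElem (show k < x.length by omega)]; rfl)).trans ?_))
    have := evalTape_write_input (x.take k) x[k]
    rw [List.length_take_of_le (by omega), List.take_append_getElem (by omega)] at this
    rw [this]
    simp only [Tape.write_read]; rfl

theorem evaluator_back (m k : ℕ) :
    evaluator.Steps (k + 1) (evalCfg .back (evalInput x code m) (evalTape x vs k) O)
      (evalCfg .main (evalInput x code (m - k)) (evalTape x vs 0) O) := by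
  induction k generalizing m with
  | zero =>
    refine RATM.Steps.single ((evaluator_step (by
      simp only [evalTr, isMark_evalTape, decide_true, if_true]; rfl)).trans ?_)
    simp only [Tape.write_read]; rfl
  | succ k ih =>
    have := ih (m - 1)
    rw [show m - 1 - k = m - (k + 1) by omega] at this
    refine RATM.Steps.head ((evaluator_step (by
      simp only [evalTr, isMark_evalTape, Nat.succ_ne_zero, decide_false, Bool.false_eq_true,
        if_false]; rfl)).trans ?_) this
    simp only [Tape.write_read]; rfl

theorem evaluator_prepare :
    evaluator.Steps (2 * x.length + 4) (evaluator.init (pair x code))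
      (evalCfg .main (evalInput x code 0) (evalTape x [] 0) (evalOutput [])) := by
  have s1 : evaluator.step (evaluator.init (pair x code)) =
      some (evalCfg .copy (evalInput x code 0) (evalTape [] [] 1) (evalOutput [])) := by
    rw [evaluator_init]
    refine (evaluator_step rfl).trans ?_
    have h1 : (Tape.ofList ([] : List EvalSym)).write (some markSym) .right = evalTape [] [] 1 := by
      refine Tape.ext' rfl fun i => ?_
      cases i <;> simp [Tape.write, Tape.ofList, evalTape, pairSym]
    have h2 : Tape.ofList ([] : List EvalSym) = evalOutput [] := by
      rw [evalOutput, Tape.map_ofList_nil]; rfl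
    rw [Tape.write_read, h1, h2]; rfl
  have s2 := evaluator_copy (x := x) (code := code) (O := evalOutput []) le_rfl
  rw [List.take_length] at s2
  have s3 : evaluator.step (evalCfg .copy (evalInput x code x.length)
      (evalTape x [] (x.length + 1)) (evalOutput [])) = some (evalCfg .back
      (evalInput x code x.length) (evalTape x [] (x.length + 1)) (evalOutput [])) := by
    refine (evaluator_step (by
      simp only [evalTr, evalInput_fst, List.getElem?_eq_none le_rfl]; rfl)).trans ?_
    simp only [Tape.write_read]; rfl
  -- The mark puts the work head one cell ahead of the input head, which therefore reaches cell 0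
  -- first and waits there.
  have s4 := evaluator_back (x := x) (vs := []) (code := code) (O := evalOutput []) x.length
    (x.length + 1)
  rw [show x.length - (x.length + 1) = 0 by omega] at s4
  have := ((RATM.Steps.single s1).trans s2).trans ((RATM.Steps.single s3).trans s4)
  rwa [show 1 + x.length + (1 + (x.length + 1 + 1)) = 2 * x.length + 4 by omega] at this

theorem length_le_length_flatMap {α β : Type} (l : List α) (f : α → List β)
    (hf : ∀ a, f a ≠ []) : l.length ≤ (l.flatMap f).length := by
  induction l with
  | nil => simp
  | cons a l ih =>
    have := List.length_pos_of_ne_nil (hf a)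
    simp only [List.length_cons, List.flatMap_cons, List.length_append]
    omega

theorem evaluator_outputsIn (G : Circuit) (x : List Bool) :
    evaluator.OutputsIn (pair x G.code) (G.outs.filterMap (outSym (G.vals x)))
      (2 * x.length + 4 + G.code.length * (8 * G.code.length + 31)) := by
  have hcode : G.code = G.gates.flatMap Gate.code ++ G.outs.flatMap outCode := rfl
  have hp : (G.outs.flatMap outCode).head? ≠ some CSym.tick := by
    cases G.outs <;> simp [outCode]
  have hg := length_le_length_flatMap G.gates Gate.code (by
    rintro (_ | ⟨_ | _⟩ | _ | _ | _) <;> simp [Gate.code])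
  have ho := length_le_length_flatMap G.outs outCode (by simp [outCode])
  have hl := congrArg List.length hcode
  rw [List.length_append] at hl
  -- The description is at least as long as the number of gates; the extra 2 leaves room for the
  -- mark and for the cell after the newest value.
  obtain ⟨t₁, ht₁, k, hk, s₁⟩ := evaluator_gates (x := x) (vs := []) (code := G.code)
    (O := evalOutput []) G.gates (p := 0) (k := 0) (H := G.code.length + 2) (by rw [← hcode]; rfl)
    hp (by omega) (by simp only [List.length_nil]; omega) (by omega)
  obtain ⟨t₂, ht₂, k', s₂⟩ := evaluator_outs (x := x) (vs := G.vals x) (code := G.code) (y := [])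
    G.outs (p := (G.gates.flatMap Gate.code).length) (by rw [hcode, List.drop_left]) hk (by omega)
  rw [← hl] at s₂
  rw [Nat.zero_add] at s₁
  refine RATM.outputsIn_of_steps ((evaluator_prepare.trans s₁).trans s₂) ?_ ?_ ?_
  · have h1 : t₁ ≤ G.code.length * (4 * (G.code.length + 2) + 9) :=
      ht₁.trans (Nat.mul_le_mul_right _ (by omega))
    have h2 : t₂ ≤ G.code.length * (4 * (G.code.length + 2) + 6) :=
      ht₂.trans (Nat.mul_le_mul_right _ (by omega))
    nlinarith
  · have : evalTr .main (evalInput x G.code G.code.length).read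
        (evalTape x (G.vals x) k').read
        (evalOutput ([] ++ G.outs.filterMap (outSym (G.vals x)))).read = none := by
      simp only [evalTr, evalInput_snd, List.drop_length, List.head?_nil]
    simp only [RATM.step, evalCfg, cond_true, cond_false, this, Option.map_none]
  · intro i
    simp [evalCfg, evalOutput, Tape.goto, Tape.map, Tape.ofList]

/-- The evaluator skips absent positions, whereas a circuit specifies its output position by
position. The two agree because the positions carrying a symbol are those of a list, hence a prefix:
after the first absent one, all are absent. -/
theorem eq_filterMap_of_getElem? {α β : Type} {f : α → Option β} {l : List α} {y : List β}
    (h : ∀ j : ℕ, y[j]? = l[j]?.bind f) : y = l.filterMap f := by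
  induction l generalizing y with
  | nil =>
    refine List.eq_nil_iff_length_eq_zero.2 (Nat.eq_zero_of_not_pos fun hy => ?_)
    have := h 0
    rw [List.getElem?_eq_getElem hy] at this
    simp at this
  | cons a l ih =>
    cases y with
    | nil =>
      have h0 := h 0
      simp only [List.getElem?_nil, List.getElem?_cons_zero, Option.bind_some] at h0
      rw [List.filterMap_cons_none h0.symm]
      refine ih fun j => ?_
      simpa using h (j + 1)
    | cons b y =>
      have h0 := h 0
      simp only [List.getElem?_cons_zero, Option.bind_some] at h0
      rw [List.filterMap_cons_some h0.symm, ← ih fun j => by simpa using h (j + 1)]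

end Evaluator

/-- The uniformity machine writes the circuit description in polynomial time, which also bounds its
length; the evaluator is quadratic in that length and linear in the input. -/
theorem NC.polyTime {f : List Bool → List Bool} (hf : NC f) : PolyTime f := by
  obtain ⟨G, _, _, _, ⟨M₁, p, _, o₁, h₁⟩, -, -, hG⟩ := hf
  have hfin : Finite CSym := by
    refine Finite.of_injective (β := Fin 9) (fun c => match c with
      | .inp => 0 | .tt => 1 | .ff => 2 | .neg => 3 | .conj => 4 | .disj => 5 | .out => 6
      | .tick => 7 | .sep => 8) ?_
    intro a b; cases a <;> cases b <;> simp
  -- Forgetting the bits turns the input into its length in unary, which is what the uniformity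
  -- machine expects; the evaluator then sees the input beside the description.
  obtain ⟨M, hM, h⟩ := exists_comp (A := Bool) M₁ evaluator (Option.map fun _ => ()) pairSym
  refine ⟨M, 4 * p + (2 * Polynomial.X + 4 + p * (8 * p + 31)) + 9,
    hM o₁ evaluator_ordinary, fun x => ?_⟩
  have hx : f x = (G x.length).outs.filterMap (outSym ((G x.length).vals x)) :=
    eq_filterMap_of_getElem? (hG x)
  rw [hx]
  refine (h x (List.replicate x.length ()) _ (pair x (G x.length).code) _ _ _ (fun i => ?_)
    (h₁ x.length).1 (fun i => (pair_getElem? _ _ i).symm) (evaluator_outputsIn _ _)).mono ?_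
  · by_cases hi : i < x.length
    · rw [List.getElem?_eq_getElem hi, List.getElem?_replicate_of_lt hi]; rfl
    · rw [List.getElem?_eq_none (by omega), List.getElem?_eq_none (by simpa using hi)]; rfl
  · have hl := (h₁ x.length).1.length_le
    simp only [Polynomial.eval_add, Polynomial.eval_mul, Polynomial.eval_ofNat,
      Polynomial.eval_X]
    gcongr

theorem NC.exists_length_le {f : List Bool → List Bool} (hf : NC f) :
    ∃ p : Polynomial ℕ, ∀ x, (f x).length ≤ p.eval x.length :=
  hf.polyTime.exists_length_le

/-! ### Polylogarithmic bounds -/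

theorem exists_eval_le_pow (p : Polynomial ℕ) : ∃ C d, ∀ n, p.eval n ≤ C * (n + 1) ^ d := by
  refine ⟨p.sum fun _ a => a, p.natDegree, fun n => ?_⟩
  rw [Polynomial.eval_eq_sum, Polynomial.sum_def, Polynomial.sum_def, Finset.sum_mul]
  refine Finset.sum_le_sum fun i hi => Nat.mul_le_mul_left _ ?_
  exact (Nat.pow_le_pow_left (Nat.le_succ n) i).trans
    (Nat.pow_le_pow_right (Nat.succ_pos n) (Polynomial.le_natDegree_of_mem_supp i hi))

/-- If `p(n) ≤ C * (n + 1) ^ d`, then `C ≤ 2 ^ C` and `n + 1 ≤ 2 ^ (log n + 1)` give `log m ≤ C + d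
* (log n + 1)`. -/
theorem exists_log_le (p : Polynomial ℕ) :
    ∃ c, ∀ m n, m ≤ p.eval n → Nat.log 2 m + 1 ≤ c * (Nat.log 2 n + 1) := by
  obtain ⟨C, d, h⟩ := exists_eval_le_pow p
  refine ⟨C + d + 1, fun m n hm => ?_⟩
  have h1 : n + 1 ≤ 2 ^ (Nat.log 2 n + 1) := Nat.lt_pow_succ_log_self (by norm_num) n
  have h2 : m ≤ 2 ^ (C + (Nat.log 2 n + 1) * d) := by
    rw [pow_add, pow_mul]
    exact (hm.trans (h n)).trans
      (Nat.mul_le_mul Nat.lt_two_pow_self.le (Nat.pow_le_pow_left h1 d))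
  have h3 := Nat.log_mono_right (b := 2) h2
  rw [Nat.log_pow (by norm_num)] at h3
  nlinarith [Nat.zero_le (Nat.log 2 n), Nat.zero_le (C * Nat.log 2 n)]

theorem exists_polylog_le (p : Polynomial ℕ) (K k : ℕ) :
    ∃ K', ∀ m n, m ≤ p.eval n → polylog K k m ≤ polylog K' k n := by
  obtain ⟨c, hc⟩ := exists_log_le p
  refine ⟨K * c ^ k, fun m n h => ?_⟩
  rw [polylog, polylog, mul_assoc, ← mul_pow]
  exact Nat.mul_le_mul_left _ (Nat.pow_le_pow_left (hc m n h) k)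

theorem polylog_add_le (K₁ K₂ k₁ k₂ n : ℕ) :
    polylog K₁ k₁ n + polylog K₂ k₂ n ≤ polylog (K₁ + K₂) (k₁ + k₂) n := by
  simp only [polylog, add_mul]
  exact Nat.add_le_add
    (Nat.mul_le_mul_left _ (Nat.pow_le_pow_right (Nat.succ_pos _) (by omega)))
    (Nat.mul_le_mul_left _ (Nat.pow_le_pow_right (Nat.succ_pos _) (by omega)))

/-- A crude bound, sufficient for showing that a solution produced in polylogarithmic time has
polynomial length. -/
theorem polylog_le_pow (K k n : ℕ) : polylog K k n ≤ K * (n + 1) ^ k :=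
  Nat.mul_le_mul_left _ (Nat.pow_le_pow_left (Nat.succ_le_succ (Nat.log_le_self 2 n)) k)

/-! ### Optimum and approximation ratio -/

namespace OptProblem

variable {Pb : OptProblem} {D P y : List Bool}

/-- The infimum or supremum defining `opt` is attained, so `opt` inherits the positivity of the
measure. -/
theorem exists_opt_eq (hi : Pb.inst D P) : ∃ y ∈ Pb.sol D P, Pb.opt D P = Pb.meas D P y := by
  obtain ⟨y, hy, h⟩ := Pb.exists_opt D P hi
  refine ⟨y, hy, ?_⟩
  unfold opt
  split at h
  · exact IsLeast.csInf_eq ⟨⟨y, hy, rfl⟩, by rintro _ ⟨z, hz, rfl⟩; exact h z hz⟩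
  · exact IsGreatest.csSup_eq ⟨⟨y, hy, rfl⟩, by rintro _ ⟨z, hz, rfl⟩; exact h z hz⟩

theorem opt_pos (hi : Pb.inst D P) : 0 < Pb.opt D P := by
  obtain ⟨y, hy, h⟩ := exists_opt_eq hi
  exact h ▸ Pb.meas_pos D P hi y hy

theorem opt_le (hg : Pb.goal = Goal.min) (hi : Pb.inst D P) (hy : y ∈ Pb.sol D P) :
    Pb.opt D P ≤ Pb.meas D P y := by
  unfold opt
  rw [hg]
  refine csInf_le ⟨0, ?_⟩ ⟨y, hy, rfl⟩
  rintro _ ⟨z, hz, rfl⟩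
  exact (Pb.meas_pos D P hi z hz).le

theorem le_opt (hg : Pb.goal = Goal.max) (hi : Pb.inst D P) (hy : y ∈ Pb.sol D P) :
    Pb.meas D P y ≤ Pb.opt D P := by
  obtain ⟨z, -, h⟩ := Pb.exists_opt D P hi
  simp only [hg] at h
  unfold opt
  rw [hg]
  refine le_csSup ⟨Pb.meas D P z, ?_⟩ ⟨y, hy, rfl⟩
  rintro _ ⟨w, hw, rfl⟩
  exact h w hw

/-- For a minimum this is `meas ≤ (1 + δ) * opt`. For a maximum, `opt ≤ (1 + δ) * meas` gives an
error of at most `δ * meas`, and `meas ≤ opt`. -/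
theorem abs_sub_le_of_ratio_le {δ : ℝ} (hδ : 0 ≤ δ) (hi : Pb.inst D P) (hy : y ∈ Pb.sol D P)
    (h : Pb.ratio D P y ≤ 1 + δ) : |Pb.opt D P - Pb.meas D P y| ≤ δ * Pb.opt D P := by
  have h0 := opt_pos hi
  have h1 := Pb.meas_pos D P hi y hy
  obtain ⟨h2, h3⟩ := max_le_iff.1 h
  rw [div_le_iff₀ h0] at h2
  rw [div_le_iff₀ h1] at h3
  cases hg : Pb.goal
  · have := opt_le hg hi hy
    rw [abs_le]; constructor <;> nlinarith
  · have := le_opt hg hi hy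
    rw [abs_le]; constructor <;> nlinarith

theorem ratio_le_of_min {ε : ℝ} (hε : 0 ≤ ε) (hg : Pb.goal = Goal.min) (hi : Pb.inst D P)
    (hy : y ∈ Pb.sol D P) (h : |Pb.opt D P - Pb.meas D P y| ≤ ε * Pb.opt D P) :
    Pb.ratio D P y ≤ 1 + ε := by
  have h0 := opt_pos hi
  have h1 := Pb.meas_pos D P hi y hy
  have h2 := opt_le hg hi hy
  rw [abs_le] at h
  refine max_le ?_ ?_
  · rw [div_le_iff₀ h0]; linarith
  · rw [div_le_iff₀ h1]; nlinarith

/-- The error bound says `meas ≥ (1 - ε) * opt`; dividing by `1 - ε` needs `ε < 1`. -/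
theorem ratio_le_of_max {ε : ℝ} (hε : 0 ≤ ε) (hε' : ε < 1) (hg : Pb.goal = Goal.max)
    (hi : Pb.inst D P) (hy : y ∈ Pb.sol D P)
    (h : |Pb.opt D P - Pb.meas D P y| ≤ ε * Pb.opt D P) :
    Pb.ratio D P y ≤ 1 + ε / (1 - ε) := by
  have h0 := opt_pos hi
  have h1 := Pb.meas_pos D P hi y hy
  have h2 := le_opt hg hi hy
  have h3 : 0 < 1 - ε := by linarith
  have h4 : 1 + ε / (1 - ε) = 1 / (1 - ε) := by field_simp; ring
  rw [abs_le] at h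
  refine max_le ?_ ?_
  · refine ((div_le_one h0).2 h2).trans ?_
    have := div_nonneg hε h3.le
    linarith
  · rw [h4, div_le_div_iff₀ h1 h3]; linarith

end OptProblem

/-! ### Transfer of approximation algorithms along reductions -/

/-- A reduction transports approximation algorithms whenever it transports the quality of
solutions. -/
theorem HasPolylogApprox.of_reduction {Pb₁ Pb₂ : OptProblem} {f₁ f₂ : List Bool → List Bool}
    {g h : List Bool → List Bool → List Bool} (hred : IsPolylogReduction Pb₁ Pb₂ f₁ f₂ g h)
    {r r' : ℝ} (happ : HasPolylogApprox Pb₂ r)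
    (hr : ∀ D P, Pb₁.inst D P → ∀ y ∈ Pb₂.sol (f₁ D) (g (f₂ D) P),
      Pb₂.ratio (f₁ D) (g (f₂ D) P) y ≤ r → Pb₁.ratio D P (h (f₂ D) y) ≤ r') :
    HasPolylogApprox Pb₁ r' := by
  obtain ⟨Γ, hΓ, pre, MA, KA, kA, hpre, hA⟩ := happ
  obtain ⟨Mg, Kg, kg, hg⟩ := hred.time_g
  obtain ⟨Mh, Kh, kh, hh⟩ := hred.time_h
  -- The input has three tracks: `f₂ D`, the preprocessed `f₁ D`, and `P`. `Mg` sees the first and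
  -- third, `MA` the second together with the output of `Mg`.
  obtain ⟨N, -, hN⟩ := exists_comp (A := Option (Option Bool × Option Γ) × Option Bool) Mg MA
    (fun s => pairSym ((s.bind Prod.fst).bind Prod.fst) (s.bind Prod.snd))
    fun s z => pairSym ((s.bind Prod.fst).bind Prod.snd) z
  -- `Mh` sees the track with `f₂ D` together with the solution found by `N`.
  obtain ⟨M, -, hM⟩ := exists_comp N Mh id
    fun s z => pairSym ((s.bind Prod.fst).bind Prod.fst) z
  obtain ⟨p₁, hp₁⟩ := hred.nc₁.exists_length_le
  obtain ⟨p₂, hp₂⟩ := hred.nc₂.exists_length_le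
  obtain ⟨Cg, hCg⟩ := exists_polylog_le p₂ Kg kg
  obtain ⟨CA, hCA⟩ := exists_polylog_le p₁ KA kA
  -- The time of `Mh` also depends on the length of the solution, bounded here by the time of `MA`,
  -- at most `CA * (|D| + 1) ^ kA`.
  obtain ⟨Ch, hCh⟩ := exists_polylog_le (p₂ + Polynomial.C CA * (Polynomial.X + 1) ^ kA) Kh kh
  refine ⟨_, inferInstance, fun D => pair (f₂ D) (pre (f₁ D)), M,
    -- Two nested compositions cost `4 * (4 * tg + tA + 9) + th + 9`; the additive 45 is treated as
    -- a polylogarithm with exponent 0.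
    16 * Cg + 4 * CA + Ch + 45, kg + kA + kh + 0,
    hred.nc₂.polyTime.pair (hpre.comp hred.nc₁.polyTime), fun D P hi => ?_⟩
  obtain ⟨y, hy, hout, hratio⟩ := hA _ _ (hred.inst_map D P hi)
  refine ⟨h (f₂ D) y, hred.sol_map D P hi y hy, ?_, hr D P hi y hy hratio⟩
  have hout' := hout.mono (hCA _ _ (hp₁ D))
  have hlen : (f₂ D).length + y.length ≤
      (p₂ + Polynomial.C CA * (Polynomial.X + 1) ^ kA).eval D.length := by
    have := hout'.length_le.trans (polylog_le_pow CA kA D.length)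
    simpa using Nat.add_le_add (hp₂ D) this
  have e1 := hN (pair (pair (f₂ D) (pre (f₁ D))) P) (pair (f₂ D) P) (g (f₂ D) P)
    (pair (pre (f₁ D)) (g (f₂ D) P)) y _ _
    (fun i => by simp only [pair_getElem?, pairSym_fst, pairSym_snd])
    ((hg _ _ ⟨D, hi, rfl⟩).mono (hCg _ _ (hp₂ D)))
    (fun i => by simp only [pair_getElem?, pairSym_fst, pairSym_snd]) hout'
  refine (hM _ _ _ (pair (f₂ D) y) _ _ _ (fun _ => rfl) e1
    (fun i => by simp only [pair_getElem?, pairSym_fst])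
    ((hh _ _ ⟨D, P, hi, rfl, hy⟩).mono (hCh _ _ hlen))).mono ?_
  have b1 := polylog_add_le (16 * Cg) (4 * CA) kg kA D.length
  have b2 := polylog_add_le (16 * Cg + 4 * CA) Ch (kg + kA) kh D.length
  have b3 := polylog_add_le (16 * Cg + 4 * CA + Ch) 45 (kg + kA + kh) 0 D.length
  have c1 : polylog (16 * Cg) kg D.length = 16 * polylog Cg kg D.length := by
    simp only [polylog, mul_assoc]
  have c2 : polylog (4 * CA) kA D.length = 4 * polylog CA kA D.length := by
    simp only [polylog, mul_assoc]
  have c3 : polylog 45 0 D.length = 45 := by simp [polylog]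
  omega

end PsPL

/-! ### Approximation guarantees under L-reductions -/

theorem theorem10 (Pb₁ Pb₂ : PsPL.OptProblem) (α β δ : ℝ)
    (hα : 0 ≤ α) (hβ : 0 ≤ β) (hδ : 0 ≤ δ)
    (hred : PsPL.LReducible Pb₁ Pb₂ α β)
    (happ : PsPL.HasPolylogApprox Pb₂ (1 + δ)) :
    (Pb₁.goal = PsPL.Goal.min → PsPL.HasPolylogApprox Pb₁ (1 + α * β * δ)) ∧
    (Pb₁.goal = PsPL.Goal.max → α * β * δ < 1 →
      PsPL.HasPolylogApprox Pb₁ (1 + α * β * δ / (1 - α * β * δ))) := by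
  obtain ⟨f₁, f₂, g, h, hred, hL⟩ := hred
  have hε : 0 ≤ α * β * δ := mul_nonneg (mul_nonneg hα hβ) hδ
  have key : ∀ D P, Pb₁.inst D P → ∀ y ∈ Pb₂.sol (f₁ D) (g (f₂ D) P),
      Pb₂.ratio (f₁ D) (g (f₂ D) P) y ≤ 1 + δ →
      |Pb₁.opt D P - Pb₁.meas D P (h (f₂ D) y)| ≤ α * β * δ * Pb₁.opt D P := by
    intro D P hi y hy hr
    obtain ⟨h1, h2⟩ := hL D P hi
    calc _ ≤ β * |Pb₂.opt (f₁ D) (g (f₂ D) P) - Pb₂.meas (f₁ D) (g (f₂ D) P) y| := h2 y hy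
      _ ≤ β * (δ * (α * Pb₁.opt D P)) := by
        refine mul_le_mul_of_nonneg_left ?_ hβ
        exact (PsPL.OptProblem.abs_sub_le_of_ratio_le hδ (hred.inst_map D P hi) hy hr).trans
          (mul_le_mul_of_nonneg_left h1 hδ)
      _ = α * β * δ * Pb₁.opt D P := by ring
  exact ⟨fun hg => happ.of_reduction hred fun D P hi y hy hr =>
      PsPL.OptProblem.ratio_le_of_min hε hg hi (hred.sol_map D P hi y hy) (key D P hi y hy hr),
    fun hg hlt => happ.of_reduction hred fun D P hi y hy hr =>
      PsPL.OptProblem.ratio_le_of_max hε hlt hg hi (hred.sol_map D P hi y hy)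
        (key D P hi y hy hr)⟩
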